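/- Let $f:\mathbb R^n\to\mathbb R$ be continuously differentiable and $\varphi:\mathbb R^n\to(-\infty,\infty]$ be proper and lower semicontinuous. Put $\psi=f+\varphi$ and $\operatorname{dom}\varphi=\{x:\varphi(x)<\infty\}$. Assume: * (C.1) there are $\bar f\in\mathbb R$ and $\mathsf L>0$ such that $f\ge\bar f$ on $\mathbb R^n$ and $\nabla f$ is Lipschitz continuous with modulus $\mathsf L$; * (C.2) $\varphi$ is $\tau$-weakly convex for some $\tau\ge 0$, i.e. $\varphi+\frac\tau2\|\cdot\|^2$ is convex, and $\varphi\ge\bar\varphi$ for some $\bar\varphi\in\mathbb R$; * (C.3) there is $\mathsf L_\varphi>0$ with $\varphi(x)-\varphi(y)\le\mathsf L_\varphi\|x-y\|$ for all $x,y\in\operatorname{dom}\varphi$. Let $(\Omega,\mathcal F,\{\mathcal F_k\}_{k\ge0},\mathbb P)$ be a filtered probability space, let $\alpha_k>0$ be step sizes, and let $\{x^k\}_{k\ge 0}$ be random vectors in $\mathbb R^n$, adapted to $\{\mathcal F_k\}$ and generated by prox-SGD: almost surely, for all $k\ge0$, $$x^{k+1}=\mathrm{prox}_{\alpha_k\varphi}(x^k-\alpha_kg^k),\qquad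 \mathrm{prox}_{\alpha\varphi}(z)\in\operatorname*{argmin}_{y\in\mathbb R^n}\ \varphi(y)+\tfrac1{2\alpha}\|z-y\|^2,$$ where the $g^k$ are integrable random vectors (for the finitely many $k$ with $\alpha_k\tau\ge1$, where the minimizer need not be unique, any minimizer may be chosen). Assume further: * (C.4) $\mathbb E[g^k\mid\mathcal F_k]=\nabla f(x^k)$ almost surely for all $k$, and there are $\mathsf C,\mathsf D\ge0$ such that $\mathbb E[\|g^k-\nabla f(x^k)\|^2\mid\mathcal F_k]\le\mathsf C[f(x^k)-\bar f]+\mathsf D$ almost surely for all $k$; * (C.5) $\sum_{k}\alpha_k=\infty$ and $\sum_k\alpha_k^2<\infty$. For $\lambda>0$ with $\lambda\tau<1$ the minimizer defining $\mathrm{prox}_{\lambda\varphi}$ is unique; let $F^\lambda_{\mathrm{nat}}(x)=x-\mathrm{prox}_{\lambda\varphi}(x-\lambda\nabla f(x))$ be the natural residual. Then, for every $\lambda>0$ with $\lambda\tau<1$ (in particular for $F_{\mathrm{nat}}=F^1_{\mathrm{nat}}$ if $\tau<1$): 1. If the Moreau envelope $\mathrm{env}_{\theta\psi}(x)=\inf_y\,\psi(y)+\frac1{2\theta}\|x-y\|^2$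 satisfies $\mathbb E[\mathrm{env}_{\theta\psi}(x^0)]<\infty$ for some $\theta>0$ (for example, if $x^0$ is deterministic or square integrable), then $F^\lambda_{\mathrm{nat}}(x^k)$ is integrable for every $k$ and $\lim_{k\to\infty}\mathbb E[\|F^\lambda_{\mathrm{nat}}(x^k)\|]=0$. 2. $\lim_{k\to\infty}\|F^\lambda_{\mathrm{nat}}(x^k)\|=0$ almost surely. -/

import Mathlib

open MeasureTheory ProbabilityTheory Filter Topology

noncomputable section

/-- The effective domain of an extended-real-valued function. -/
def effDom {E : Type*} (h : E → EReal) : Set E := {x | h x < ⊤}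

/-- `h : E → (-∞, ∞]` is `τ`-weakly convex: `h + (τ / 2) ‖·‖²` is convex on its effective domain
(convexity of the domain is part of `ConvexOn`). The value `-∞` is excluded, so that `toReal` is
the actual value of `h` on `effDom h`. -/
def WeaklyConvex {E : Type*} [NormedAddCommGroup E] [NormedSpace ℝ E]
    (τ : ℝ) (h : E → EReal) : Prop :=
  (∀ x, h x ≠ ⊥) ∧ ConvexOn ℝ (effDom h) (fun x => (h x).toReal + τ / 2 * ‖x‖ ^ 2)

/-- The objective `y ↦ h y + ‖z - y‖² / (2 α)` of the proximal subproblem. -/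
def proxObj {E : Type*} [NormedAddCommGroup E] (α : ℝ) (h : E → EReal) (z y : E) : EReal :=
  h y + ((‖z - y‖ ^ 2 / (2 * α) : ℝ) : EReal)

/-- The set `argmin_y h y + ‖z - y‖² / (2 α)` of global minimizers. -/
def proxSet {E : Type*} [NormedAddCommGroup E] (α : ℝ) (h : E → EReal) (z : E) : Set E :=
  {p | ∀ y, proxObj α h z p ≤ proxObj α h z y}

/-- The proximity operator `prox_{α h}`. It is the unique element of `proxSet α h z` whenever
`h` is proper, lower semicontinuous and `τ`-weakly convex, and `0 < α`, `α τ < 1`. -/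
def prox {E : Type*} [NormedAddCommGroup E] (α : ℝ) (h : E → EReal) (z : E) : E :=
  Classical.epsilon (fun p => p ∈ proxSet α h z)

/-- The Moreau envelope `env_{θ h} x = inf_y h y + ‖x - y‖² / (2 θ)`. -/
def moreauEnv {E : Type*} [NormedAddCommGroup E] (θ : ℝ) (h : E → EReal) (x : E) : EReal :=
  ⨅ y, proxObj θ h x y

/-- The natural residual `F_nat^lam x = x - prox_{lam φ} (x - lam ∇f(x))` of `min f + φ`. -/
def natRes {E : Type*} [NormedAddCommGroup E] [InnerProductSpace ℝ E] [CompleteSpace E]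
    (lam : ℝ) (f : E → ℝ) (φ : E → EReal) (x : E) : E :=
  x - prox lam φ (x - lam • gradient f x)

end

/-!
The iterates are followed through the Moreau envelope `W` of `ψ = f + φ` for a fixed small parameter
and through the distance `G x = ‖x - prox_ψ x‖`, which is proportional to the norm of the gradient
of `W` and dominates the natural residual for every `lam`. Comparing a step of prox-SGD with the
proximal point of `ψ` gives `E[W (k + 1) | ℱ k] ≤ (1 + c α k ^ 2) W k - ρ α k G k ^ 2`, so that, by
Robbins–Siegmund, `W` stays bounded, in mean and almost surely, and `∑ α k * G k ^ 2 < ∞`. Since `G`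
is Lipschitz and a step has mean square length `O(α k ^ 2 * W k)`, `G` can only decrease at a rate
`O(α k)`, up to a convergent martingale in the almost sure case; as `∑ α k = ∞`, this forces
`G k → 0`. Localising to the events `W 0 ≤ m` of `ℱ 0` removes the integrability of `W 0` from the
almost sure statement.
-/

section Smooth

variable {E : Type*} [NormedAddCommGroup E] [InnerProductSpace ℝ E] [CompleteSpace E]
  {f : E → ℝ} {L : NNReal}

lemma hasDerivAt_comp_add_smul {u : E → ℝ} {v p d : E} {t : ℝ}
    (hu : HasGradientAt u v (p + t • d)) :
    HasDerivAt (fun s : ℝ => u (p + s • d)) (inner ℝ v d) t := by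
  have hline : HasDerivAt (fun s : ℝ => p + s • d) d t := by
    simpa using ((hasDerivAt_id t).smul_const d).const_add p
  have h := hu.hasFDerivAt.comp_hasDerivAt t hline
  rwa [InnerProductSpace.toDual_apply_apply] at h

theorem abs_sub_sub_inner_gradient_le (hf : Differentiable ℝ f)
    (hL : LipschitzWith L (gradient f)) (x y : E) :
    |f y - f x - inner ℝ (gradient f x) (y - x)| ≤ L / 2 * ‖y - x‖ ^ 2 := by
  set d := y - x
  set r : ℝ → ℝ := fun t => f (x + t • d) - f x - t * inner ℝ (gradient f x) d
  have hr (t : ℝ) :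
      HasDerivAt r (inner ℝ (gradient f (x + t • d) - gradient f x) d) t := by
    rw [inner_sub_left]
    exact ((hasDerivAt_comp_add_smul (hf _).hasGradientAt).sub_const _).sub
      (hasDerivAt_mul_const _)
  have hB (t : ℝ) : HasDerivAt (fun t => L / 2 * ‖d‖ ^ 2 * t ^ 2) (L * ‖d‖ ^ 2 * t) t := by
    refine ((hasDerivAt_pow 2 t).const_mul (L / 2 * ‖d‖ ^ 2 : ℝ)).congr_deriv ?_
    push_cast
    ring
  have hr_le (t : ℝ) (ht : t ∈ Set.Ico (0 : ℝ) 1) :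
      ‖inner ℝ (gradient f (x + t • d) - gradient f x) d‖ ≤ L * ‖d‖ ^ 2 * t :=
    calc _ ≤ ‖gradient f (x + t • d) - gradient f x‖ * ‖d‖ := norm_inner_le_norm _ _
      _ ≤ L * ‖x + t • d - x‖ * ‖d‖ := by gcongr; exact hL.norm_sub_le _ _
      _ = L * ‖d‖ ^ 2 * t := by
        rw [add_sub_cancel_left, norm_smul, Real.norm_of_nonneg ht.1]; ring
  have hr_one := image_norm_le_of_norm_deriv_right_le_deriv_boundary
    (fun t _ => (hr t).continuousAt.continuousWithinAt) (fun t _ => (hr t).hasDerivWithinAt)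
    (by simp [r]) hB hr_le (Set.right_mem_Icc.2 zero_le_one)
  simpa [r, d] using hr_one

theorem norm_gradient_sq_le (hf : Differentiable ℝ f) (hL : LipschitzWith L (gradient f))
    {m : ℝ} (hm : ∀ y, m ≤ f y) (x : E) :
    ‖gradient f x‖ ^ 2 ≤ 2 * L * (f x - m) := by
  rcases (sq_nonneg ‖gradient f x‖).eq_or_lt with h0 | hpos
  · rw [← h0]
    exact mul_nonneg (by positivity) (sub_nonneg.2 (hm x))
  have hquad (t : ℝ) : 0 ≤ L / 2 * ‖gradient f x‖ ^ 2 * (t * t) + -‖gradient f x‖ ^ 2 * t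
      + (f x - m) := by
    have h := (abs_le.1 (abs_sub_sub_inner_gradient_le hf hL x (x - t • gradient f x))).2
    rw [sub_sub_cancel_left, inner_neg_right, inner_smul_right, real_inner_self_eq_norm_sq,
      norm_neg, norm_smul, mul_pow, Real.norm_eq_abs, sq_abs] at h
    linarith [hm (x - t • gradient f x)]
  have hdiscrim := discrim_le_zero hquad
  refine le_of_mul_le_mul_left ?_ hpos
  unfold discrim at hdiscrim
  linarith

lemma sub_le_two_mul_sub_add_norm_sq (hf : Differentiable ℝ f) (hL : LipschitzWith L (gradient f))
    {m : ℝ} (hm : ∀ y, m ≤ f y) (x y : E) :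
    f y - m ≤ 2 * (f x - m) + L * ‖y - x‖ ^ 2 := by
  have hfx : 0 ≤ f x - m := sub_nonneg.2 (hm x)
  have hcs : ‖gradient f x‖ * ‖y - x‖ ≤ (f x - m) + L / 2 * ‖y - x‖ ^ 2 := by
    refine (sq_le_sq₀ (by positivity) (by positivity)).1 ?_
    calc (‖gradient f x‖ * ‖y - x‖) ^ 2 = ‖gradient f x‖ ^ 2 * ‖y - x‖ ^ 2 := mul_pow _ _ _
      _ ≤ 2 * L * (f x - m) * ‖y - x‖ ^ 2 := by gcongr; exact norm_gradient_sq_le hf hL hm x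
      _ = 4 * (f x - m) * (L / 2 * ‖y - x‖ ^ 2) := by ring
      _ ≤ ((f x - m) + L / 2 * ‖y - x‖ ^ 2) ^ 2 := four_mul_le_sq_add _ _
  linarith [(abs_le.1 (abs_sub_sub_inner_gradient_le hf hL x y)).2,
    real_inner_le_norm (gradient f x) (y - x)]

theorem strongConvexOn_neg_of_lipschitzWith_gradient (hf : Differentiable ℝ f)
    (hL : LipschitzWith L (gradient f)) : StrongConvexOn Set.univ (-L : ℝ) f := by
  refine ⟨convex_univ, fun x _ y _ a b ha hb hab => ?_⟩
  obtain rfl : b = 1 - a := by linarith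
  set z := a • x + (1 - a) • y
  have hxz : x - z = (1 - a) • (x - y) := by module
  have hyz : y - z = -a • (x - y) := by module
  have hx := (abs_le.1 (abs_sub_sub_inner_gradient_le hf hL z x)).1
  have hy := (abs_le.1 (abs_sub_sub_inner_gradient_le hf hL z y)).1
  rw [hxz, inner_smul_right, norm_smul, mul_pow, Real.norm_eq_abs, sq_abs] at hx
  rw [hyz, inner_smul_right, norm_smul, mul_pow, Real.norm_eq_abs, sq_abs] at hy
  simp only [smul_eq_mul]
  linarith [mul_le_mul_of_nonneg_left hx ha, mul_le_mul_of_nonneg_left hy hb]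

end Smooth

section WeaklyConvex

variable {E : Type*} [NormedAddCommGroup E]

lemma effDom_coe_add {X : Type*} (u : X → ℝ) (φ : X → EReal) :
    effDom (fun y => (u y : EReal) + φ y) = effDom φ := by
  ext y
  exact lt_top_iff_ne_top.trans ((EReal.add_ne_top_iff_ne_top_right (EReal.coe_ne_bot _)
    (EReal.coe_ne_top _)).trans lt_top_iff_ne_top.symm)

lemma toReal_coe_add {u : ℝ} {a : EReal} (hbot : a ≠ ⊥) (htop : a < ⊤) :
    ((u : EReal) + a).toReal = u + a.toReal := by
  rw [EReal.toReal_add (EReal.coe_ne_top _) (EReal.coe_ne_bot _) htop.ne hbot, EReal.toReal_coe]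

lemma add_toReal_le_add_toReal {u v : ℝ} {a b : EReal} (ha : a ≠ ⊥) (hb : b ≠ ⊥) (hb' : b < ⊤)
    (hab : (u : EReal) + a ≤ v + b) : u + a.toReal ≤ v + b.toReal := by
  lift b to ℝ using ⟨hb'.ne, hb⟩
  induction a with
  | bot => exact absurd rfl ha
  | coe a => exact_mod_cast hab
  | top => exact absurd hab (by simp [← EReal.coe_add])

lemma lowerSemicontinuous_coe_add {u : E → ℝ} {φ : E → EReal} (hu : Continuous u)
    (hφ : LowerSemicontinuous φ) : LowerSemicontinuous fun y => (u y : EReal) + φ y :=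
  (continuous_coe_real_ereal.comp hu).lowerSemicontinuous.add' hφ fun _ =>
    EReal.continuousAt_add (Or.inl (EReal.coe_ne_top _)) (Or.inl (EReal.coe_ne_bot _))

lemma proxObj_eq_coe_add (α : ℝ) (φ : E → EReal) (z : E) :
    proxObj α φ z = fun y => ((‖z - y‖ ^ 2 / (2 * α) : ℝ) : EReal) + φ y :=
  funext fun _ => add_comm _ _

lemma mem_effDom_of_forall_coe_add_le {X : Type*} {u : X → ℝ} {φ : X → EReal} {p : X}
    (hne : (effDom φ).Nonempty) (hp : ∀ y, (u p : EReal) + φ p ≤ u y + φ y) : p ∈ effDom φ := by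
  rw [← effDom_coe_add u] at hne ⊢
  obtain ⟨y, hy⟩ := hne
  exact (hp y).trans_lt hy

variable [InnerProductSpace ℝ E] {φ : E → EReal} {τ : ℝ}

lemma strongConvexOn_norm_sub_sq_div (z : E) (α : ℝ) :
    StrongConvexOn Set.univ α⁻¹ fun y => ‖z - y‖ ^ 2 / (2 * α) := by
  refine strongConvexOn_iff_convex.2 ⟨convex_univ, fun x _ y _ a b _ _ hab => le_of_eq ?_⟩
  obtain rfl : b = 1 - a := by linarith
  simp only [norm_sub_sq_real, inner_add_right, inner_smul_right, smul_eq_mul]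
  ring

namespace WeaklyConvex

lemma strongConvexOn (hφ : WeaklyConvex τ φ) :
    StrongConvexOn (effDom φ) (-τ) fun y => (φ y).toReal := by
  refine strongConvexOn_iff_convex.2 (hφ.2.congr fun y _ => ?_)
  ring

lemma coe_add {u : E → ℝ} {σ : ℝ} (hu : StrongConvexOn Set.univ (-σ) u)
    (hφ : WeaklyConvex τ φ) : WeaklyConvex (σ + τ) fun y => (u y : EReal) + φ y := by
  refine ⟨fun y => by simp [EReal.add_eq_bot_iff, hφ.1 y], ?_⟩
  rw [effDom_coe_add]
  refine (((strongConvexOn_iff_convex.1 hu).subset (Set.subset_univ _) hφ.2.1).add hφ.2).congr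
    fun y hy => ?_
  simp only [Pi.add_apply]
  rw [toReal_coe_add (hφ.1 y) hy]
  ring

lemma weaklyConvex_proxObj (hφ : WeaklyConvex τ φ) (α : ℝ) (z : E) :
    WeaklyConvex (τ - α⁻¹) (proxObj α φ z) := by
  rw [proxObj_eq_coe_add, sub_eq_neg_add]
  exact coe_add (by simpa using strongConvexOn_norm_sub_sq_div z α) hφ

lemma norm_sub_sq_le_of_le_add (hφ : WeaklyConvex τ φ) {m ε : ℝ}
    (hm : ∀ y, (m : EReal) ≤ φ y) {x y : E} (hx : φ x ≤ ((m + ε : ℝ) : EReal))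
    (hy : φ y ≤ ((m + ε : ℝ) : EReal)) : -τ * ‖x - y‖ ^ 2 ≤ 8 * ε := by
  have hxd : x ∈ effDom φ := hx.trans_lt (EReal.coe_lt_top _)
  have hyd : y ∈ effDom φ := hy.trans_lt (EReal.coe_lt_top _)
  obtain ⟨hconv, hineq⟩ : UniformConvexOn _ _ _ := hφ.strongConvexOn
  have hhalf : (1 / 2 : ℝ) + 1 / 2 = 1 := by norm_num
  have hmid := hineq hxd hyd one_half_pos.le one_half_pos.le hhalf
  have hmid_ge := EReal.toReal_le_toReal (hm ((1 / 2 : ℝ) • x + (1 / 2 : ℝ) • y))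
    (EReal.coe_ne_bot _) (ne_of_lt (hconv hxd hyd one_half_pos.le one_half_pos.le hhalf))
  have hx' := EReal.toReal_le_toReal hx (hφ.1 x) (EReal.coe_ne_top _)
  have hy' := EReal.toReal_le_toReal hy (hφ.1 y) (EReal.coe_ne_top _)
  simp only [EReal.toReal_coe, smul_eq_mul] at hmid_ge hx' hy' hmid
  linarith

theorem exists_forall_le [CompleteSpace E] (hφ : WeaklyConvex τ φ) (hτ : τ < 0)
    (hne : (effDom φ).Nonempty) (hlsc : LowerSemicontinuous φ) {b : ℝ}
    (hb : ∀ y, (b : EReal) ≤ φ y) : ∃ p, ∀ y, φ p ≤ φ y := by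
  set m := sInf ((fun y => (φ y).toReal) '' effDom φ)
  have hbdd : BddBelow ((fun y => (φ y).toReal) '' effDom φ) := by
    refine ⟨b, Set.forall_mem_image.2 fun y hy => ?_⟩
    simpa using EReal.toReal_le_toReal (hb y) (EReal.coe_ne_bot _) (ne_of_lt hy)
  have hm (y : E) : (m : EReal) ≤ φ y := by
    by_cases hy : y ∈ effDom φ
    · rw [← EReal.coe_toReal (ne_of_lt hy) (hφ.1 y), EReal.coe_le_coe_iff]
      exact csInf_le hbdd (Set.mem_image_of_mem _ hy)
    · exact (not_lt_top_iff.1 (show ¬φ y < ⊤ from hy)).symm ▸ le_top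
  have hmin (n : ℕ) : ∃ y, φ y ≤ ((m + 1 / (n + 1) : ℝ) : EReal) := by
    obtain ⟨_, ⟨y, hy, rfl⟩, hlt⟩ := exists_lt_of_csInf_lt (hne.image _)
      (lt_add_of_pos_right m (Nat.one_div_pos_of_nat (n := n)))
    refine ⟨y, ?_⟩
    rw [← EReal.coe_toReal (ne_of_lt hy) (hφ.1 y)]
    exact EReal.coe_le_coe_iff.2 hlt.le
  choose u hu using hmin
  have hu_le {k n : ℕ} (hkn : k ≤ n) : φ (u n) ≤ ((m + 1 / (k + 1) : ℝ) : EReal) :=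
    (hu n).trans (EReal.coe_le_coe_iff.2 (by gcongr))
  have hcauchy : CauchySeq u := by
    refine cauchySeq_of_le_tendsto_0 (fun n : ℕ => √(8 / -τ * (1 / (n + 1)))) ?_ ?_
    · intro n k N hn hk
      rw [dist_eq_norm]
      refine Real.le_sqrt_of_sq_le ?_
      rw [div_mul_eq_mul_div, le_div_iff₀' (neg_pos.2 hτ)]
      exact hφ.norm_sub_sq_le_of_le_add hm (hu_le hn) (hu_le hk)
    · simpa using ((tendsto_one_div_add_atTop_nhds_zero_nat (𝕜 := ℝ)).const_mul (8 / -τ)).sqrt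
  obtain ⟨p, hp⟩ := cauchySeq_tendsto_of_complete hcauchy
  have hp_le (k : ℕ) : φ p ≤ ((m + 1 / (k + 1) : ℝ) : EReal) :=
    (hlsc.isClosed_preimage _).mem_of_tendsto hp
      (eventually_atTop.2 ⟨k, fun n hn => hu_le hn⟩)
  have hlim : Tendsto (fun k : ℕ => ((m + 1 / (k + 1) : ℝ) : EReal)) atTop (𝓝 (m : EReal)) := by
    refine (continuous_coe_real_ereal.tendsto _).comp ?_
    simpa using (tendsto_one_div_add_atTop_nhds_zero_nat (𝕜 := ℝ)).const_add m
  exact ⟨p, fun y => (ge_of_tendsto' hlim hp_le).trans (hm y)⟩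

theorem proxSet_nonempty [CompleteSpace E] (hφ : WeaklyConvex τ φ)
    (hne : (effDom φ).Nonempty) (hlsc : LowerSemicontinuous φ) {b : ℝ}
    (hb : ∀ y, (b : EReal) ≤ φ y) {α : ℝ} (hα : 0 < α) (hατ : α * τ < 1) (z : E) :
    (proxSet α φ z).Nonempty := by
  refine (hφ.weaklyConvex_proxObj α z).exists_forall_le (b := b) ?_ ?_ ?_ fun y => ?_
  · rwa [sub_neg, inv_eq_one_div, lt_div_iff₀' hα]
  · rwa [proxObj_eq_coe_add, effDom_coe_add]
  · rw [proxObj_eq_coe_add]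
    exact lowerSemicontinuous_coe_add (by fun_prop) hlsc
  · exact le_add_of_le_of_nonneg (hb y) (EReal.coe_nonneg.2 (by positivity))

lemma prox_mem_proxSet [CompleteSpace E] (hφ : WeaklyConvex τ φ)
    (hne : (effDom φ).Nonempty) (hlsc : LowerSemicontinuous φ) {b : ℝ}
    (hb : ∀ y, (b : EReal) ≤ φ y) {α : ℝ} (hα : 0 < α) (hατ : α * τ < 1) (z : E) :
    prox α φ z ∈ proxSet α φ z :=
  Classical.epsilon_spec (hφ.proxSet_nonempty hne hlsc hb hα hατ z)

end WeaklyConvex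

/-- `v` is a subgradient at `p` of the `τ`-weakly convex function `φ`, in the global form
`φ y ≥ φ p + ⟪v, y - p⟫ - (τ / 2) ‖y - p‖²`; membership of `p` in the domain is included. -/
structure IsWeakSubgradient (τ : ℝ) (φ : E → EReal) (v p : E) : Prop where
  mem_effDom : p ∈ effDom φ
  add_inner_sub_le : ∀ y ∈ effDom φ,
    (φ p).toReal + inner ℝ v (y - p) - τ / 2 * ‖y - p‖ ^ 2 ≤ (φ y).toReal

lemma IsWeakSubgradient.norm_sub_le {v w p q a : E} {c : ℝ} (hp : IsWeakSubgradient τ φ v p)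
    (hq : IsWeakSubgradient τ φ w q) (hvw : v - w = a - c • (p - q)) :
    (c - τ) * ‖p - q‖ ≤ ‖a‖ := by
  have hmonotone : -τ * ‖p - q‖ ^ 2 ≤ inner ℝ (v - w) (p - q) := by
    have hpq := hp.add_inner_sub_le q hq.mem_effDom
    have hqp := hq.add_inner_sub_le p hp.mem_effDom
    rw [← neg_sub p q, inner_neg_right, norm_neg] at hpq
    rw [inner_sub_left]
    linarith
  rw [hvw, inner_sub_left, real_inner_smul_left, real_inner_self_eq_norm_sq] at hmonotone
  have hcs := real_inner_le_norm a (p - q)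
  rcases (norm_nonneg (p - q)).eq_or_lt with h0 | hpos
  · simp [← h0]
  · exact le_of_mul_le_mul_right (by linarith) hpos

variable [CompleteSpace E]

theorem WeaklyConvex.isWeakSubgradient_of_forall_le (hφ : WeaklyConvex τ φ)
    (hne : (effDom φ).Nonempty) {u : E → ℝ} {v p : E} (hu : HasGradientAt u v p)
    (hp : ∀ y, (u p : EReal) + φ p ≤ u y + φ y) : IsWeakSubgradient τ φ (-v) p := by
  have hpd := mem_effDom_of_forall_coe_add_le hne hp
  obtain ⟨hconv, hineq⟩ : UniformConvexOn _ _ _ := hφ.strongConvexOn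
  refine ⟨hpd, fun y hy => ?_⟩
  have hslope : Tendsto (fun t : ℝ => t⁻¹ * (u (p + t • (y - p)) - u p)) (𝓝[>] 0)
      (𝓝 (inner ℝ v (y - p))) := by
    simpa using (hasDerivAt_comp_add_smul (t := 0) (d := y - p)
      (by simpa using hu)).tendsto_slope_zero_right
  have hquad : Tendsto (fun t : ℝ => (φ p).toReal - (φ y).toReal - τ / 2 * (1 - t) * ‖y - p‖ ^ 2)
      (𝓝[>] 0) (𝓝 ((φ p).toReal - (φ y).toReal - τ / 2 * ‖y - p‖ ^ 2)) :=
    ((by fun_prop : Continuous _).tendsto' 0 _ (by simp)).mono_left nhdsWithin_le_nhds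
  have hle := le_of_tendsto_of_tendsto hquad hslope ?_
  · rw [inner_neg_left]
    linarith
  filter_upwards [Ioc_mem_nhdsGT (zero_lt_one' ℝ)] with t ⟨ht0, ht1⟩
  have hcomb : (1 - t) • p + t • y = p + t • (y - p) := by module
  have hcomb_mem := hconv hpd hy (sub_nonneg.2 ht1) ht0.le (sub_add_cancel 1 t)
  have hcomb_le := hineq hpd hy (sub_nonneg.2 ht1) ht0.le (sub_add_cancel 1 t)
  rw [hcomb] at hcomb_mem hcomb_le
  have hmin := add_toReal_le_add_toReal (hφ.1 p) (hφ.1 _) hcomb_mem (hp _)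
  rw [norm_sub_rev p y] at hcomb_le
  simp only [smul_eq_mul] at hcomb_le
  rw [← mul_le_mul_iff_right₀ ht0, mul_inv_cancel_left₀ ht0.ne']
  linarith

lemma hasGradientAt_norm_sub_sq_div (α : ℝ) (z p : E) :
    HasGradientAt (fun y => ‖z - y‖ ^ 2 / (2 * α)) (α⁻¹ • (p - z)) p := by
  rw [hasGradientAt_iff_hasFDerivAt]
  refine (((hasFDerivAt_id (𝕜 := ℝ) p).const_sub z).norm_sq.mul_const (2 * α)⁻¹).congr_fderiv ?_
  ext w
  simp
  ring

theorem WeaklyConvex.isWeakSubgradient_of_mem_proxSet_coe_add (hφ : WeaklyConvex τ φ)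
    (hne : (effDom φ).Nonempty) {u : E → ℝ} {α : ℝ} {z p : E} (hu : DifferentiableAt ℝ u p)
    (hp : p ∈ proxSet α (fun y => (u y : EReal) + φ y) z) :
    IsWeakSubgradient τ φ (α⁻¹ • (z - p) - gradient u p) p := by
  have hgrad : HasGradientAt (fun y => ‖z - y‖ ^ 2 / (2 * α) + u y)
      (α⁻¹ • (p - z) + gradient u p) p := by
    rw [hasGradientAt_iff_hasFDerivAt, map_add]
    exact (hasGradientAt_norm_sub_sq_div α z p).hasFDerivAt.add hu.hasGradientAt.hasFDerivAt
  have h := hφ.isWeakSubgradient_of_forall_le hne hgrad fun y => by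
    simpa only [proxObj_eq_coe_add, EReal.coe_add, add_assoc] using hp y
  convert h using 1
  module

theorem WeaklyConvex.isWeakSubgradient_of_mem_proxSet (hφ : WeaklyConvex τ φ)
    (hne : (effDom φ).Nonempty) {α : ℝ} {z p : E} (hp : p ∈ proxSet α φ z) :
    IsWeakSubgradient τ φ (α⁻¹ • (z - p)) p := by
  have h := hφ.isWeakSubgradient_of_mem_proxSet_coe_add hne (u := fun _ => 0) (z := z) (α := α)
    (differentiableAt_const 0) (by simpa using hp)
  simpa [gradient] using h

theorem WeaklyConvex.norm_sub_le_of_mem_proxSet (hφ : WeaklyConvex τ φ)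
    (hne : (effDom φ).Nonempty) {α : ℝ} {z w p q : E} (hp : p ∈ proxSet α φ z)
    (hq : q ∈ proxSet α φ w) : (α⁻¹ - τ) * ‖p - q‖ ≤ ‖α⁻¹ • (z - w)‖ :=
  (hφ.isWeakSubgradient_of_mem_proxSet hne hp).norm_sub_le
    (hφ.isWeakSubgradient_of_mem_proxSet hne hq) (by module)

end WeaklyConvex

section CompositeProblem

variable {E : Type*} [NormedAddCommGroup E] [InnerProductSpace ℝ E]

/-- The composite problem `min f + φ` under the conditions (C.1), (C.2) and (C.3) of the paper. -/
structure CompositeProblem (E : Type*) [NormedAddCommGroup E] [InnerProductSpace ℝ E]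
    [CompleteSpace E] where
  f : E → ℝ
  φ : E → EReal
  L : NNReal
  (τ fbar φbar Lφ : ℝ)
  differentiable : Differentiable ℝ f
  lipschitz_gradient : LipschitzWith L (gradient f)
  le_f : ∀ y, fbar ≤ f y
  τ_nonneg : 0 ≤ τ
  weaklyConvex : WeaklyConvex τ φ
  nonempty : (effDom φ).Nonempty
  lowerSemicontinuous : LowerSemicontinuous φ
  le_φ : ∀ y, (φbar : EReal) ≤ φ y
  sub_le_mul_norm : ∀ y ∈ effDom φ, ∀ z ∈ effDom φ, (φ y).toReal - (φ z).toReal ≤ Lφ * ‖y - z‖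

lemma norm_sub_sq_le_two_mul (a b : E) : ‖a - b‖ ^ 2 ≤ 2 * (‖a‖ ^ 2 + ‖b‖ ^ 2) := by
  have h := parallelogram_law_with_norm ℝ a b
  linarith [mul_self_nonneg ‖a + b‖]

variable [CompleteSpace E]

namespace CompositeProblem

/-- The objective `ψ = f + φ`. -/
noncomputable def objective (P : CompositeProblem E) (y : E) : EReal := (P.f y : EReal) + P.φ y

/-- The inverse of the envelope parameter: the iterates are monitored through the Moreau envelope
of `ψ` with parameter `P.rate⁻¹`. It exceeds the weak convexity modulus `L + τ` of `ψ` by enough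
for the expansion in `norm_sub_proxPoint_sq_le_of_step` to be a contraction. -/
def rate (P : CompositeProblem E) : ℝ := P.L + 2 * P.τ + 2

/-- The proximal point `prox_{θ ψ}(x)` with `θ = P.rate⁻¹`. -/
noncomputable def proxPoint (P : CompositeProblem E) (x : E) : E := prox P.rate⁻¹ P.objective x

/-- The Moreau envelope `env_{θ ψ}(x)` with `θ = P.rate⁻¹`, shifted so that it is at least `1`.
Shifting by `1` more than the lower bound of `ψ` lets the merit absorb additive constants. -/
noncomputable def merit (P : CompositeProblem E) (x : E) : ℝ :=
  P.f (P.proxPoint x) + (P.φ (P.proxPoint x)).toReal + P.rate / 2 * ‖x - P.proxPoint x‖ ^ 2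
    - (P.fbar + P.φbar) + 1

variable (P : CompositeProblem E)

lemma rate_pos : 0 < P.rate := by
  have := P.τ_nonneg
  unfold rate
  positivity

lemma le_toReal_φ {y : E} (hy : y ∈ effDom P.φ) : P.φbar ≤ (P.φ y).toReal := by
  simpa using EReal.toReal_le_toReal (P.le_φ y) (EReal.coe_ne_bot _) (ne_of_lt hy)

lemma effDom_objective : effDom P.objective = effDom P.φ := effDom_coe_add _ _

lemma nonempty_effDom_objective : (effDom P.objective).Nonempty :=
  P.effDom_objective.symm ▸ P.nonempty

lemma weaklyConvex_objective : WeaklyConvex (P.L + P.τ) P.objective :=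
  WeaklyConvex.coe_add
    (strongConvexOn_neg_of_lipschitzWith_gradient P.differentiable P.lipschitz_gradient)
    P.weaklyConvex

lemma proxPoint_mem_proxSet (x : E) : P.proxPoint x ∈ proxSet P.rate⁻¹ P.objective x := by
  refine P.weaklyConvex_objective.prox_mem_proxSet P.nonempty_effDom_objective
    (lowerSemicontinuous_coe_add P.differentiable.continuous P.lowerSemicontinuous)
    (b := P.fbar + P.φbar) (fun y => ?_) (inv_pos.2 P.rate_pos) ?_ x
  · rw [EReal.coe_add]
    exact add_le_add (EReal.coe_le_coe_iff.2 (P.le_f y)) (P.le_φ y)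
  · rw [inv_mul_lt_one₀ P.rate_pos, rate]
    linarith [P.τ_nonneg]

lemma isWeakSubgradient_proxPoint (x : E) : IsWeakSubgradient (P.L + P.τ) P.objective
    (P.rate • (x - P.proxPoint x)) (P.proxPoint x) := by
  simpa using P.weaklyConvex_objective.isWeakSubgradient_of_mem_proxSet
    P.nonempty_effDom_objective (P.proxPoint_mem_proxSet x)

lemma proxPoint_mem_effDom (x : E) : P.proxPoint x ∈ effDom P.φ :=
  P.effDom_objective ▸ (P.isWeakSubgradient_proxPoint x).mem_effDom

lemma norm_proxPoint_sub_le (x y : E) :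
    ‖P.proxPoint x - P.proxPoint y‖ ≤ P.rate * ‖x - y‖ := by
  have h := P.weaklyConvex_objective.norm_sub_le_of_mem_proxSet P.nonempty_effDom_objective
    (P.proxPoint_mem_proxSet x) (P.proxPoint_mem_proxSet y)
  rw [inv_inv, norm_smul, Real.norm_of_nonneg P.rate_pos.le] at h
  refine le_trans (le_mul_of_one_le_left (norm_nonneg _) ?_) h
  unfold rate
  linarith [P.τ_nonneg]

lemma continuous_proxPoint : Continuous P.proxPoint :=
  (LipschitzWith.of_dist_le_mul (K := ⟨P.rate, P.rate_pos.le⟩) fun x y => by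
    rw [dist_eq_norm, dist_eq_norm]
    exact P.norm_proxPoint_sub_le x y).continuous

/-- Relative to `L + τ`, the excess `τ + 2` of `P.rate` is a modulus of strong convexity of the
proximal objective, which therefore grows quadratically around its minimizer. -/
theorem merit_add_le (x : E) {y : E} (hy : y ∈ effDom P.φ) :
    P.merit x + (P.τ / 2 + 1) * ‖y - P.proxPoint x‖ ^ 2
      ≤ P.f y + (P.φ y).toReal + P.rate / 2 * ‖x - y‖ ^ 2 - (P.fbar + P.φbar) + 1 := by
  have h := (P.isWeakSubgradient_proxPoint x).add_inner_sub_le y (P.effDom_objective.symm ▸ hy)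
  have hsq := norm_sub_sq_real (x - P.proxPoint x) (y - P.proxPoint x)
  rw [sub_sub_sub_cancel_right] at hsq
  rw [objective, objective, toReal_coe_add (P.weaklyConvex.1 _) hy,
    toReal_coe_add (P.weaklyConvex.1 _) (P.proxPoint_mem_effDom x), real_inner_smul_left] at h
  rw [merit, hsq]
  unfold rate at *
  linarith

lemma merit_le (x : E) {y : E} (hy : y ∈ effDom P.φ) : P.merit x
      ≤ P.f y + (P.φ y).toReal + P.rate / 2 * ‖x - y‖ ^ 2 - (P.fbar + P.φbar) + 1 := by
  have hgrowth : 0 ≤ (P.τ / 2 + 1) * ‖y - P.proxPoint x‖ ^ 2 := by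
    have := P.τ_nonneg
    positivity
  linarith [P.merit_add_le x hy]

lemma merit_le_merit_add (x y : E) : P.merit x ≤ P.merit y
      + P.rate / 2 * (‖x - P.proxPoint y‖ ^ 2 - ‖y - P.proxPoint y‖ ^ 2) := by
  refine (P.merit_le x (P.proxPoint_mem_effDom y)).trans_eq ?_
  unfold merit
  ring

lemma continuous_merit : Continuous P.merit := by
  have hp := P.continuous_proxPoint
  refine continuous_iff_continuousAt.2 fun x => ?_
  refine tendsto_of_tendsto_of_tendsto_of_le_of_le
    (g := fun y => P.merit x
      - P.rate / 2 * (‖x - P.proxPoint y‖ ^ 2 - ‖y - P.proxPoint y‖ ^ 2))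
    (h := fun y => P.merit x
      + P.rate / 2 * (‖y - P.proxPoint x‖ ^ 2 - ‖x - P.proxPoint x‖ ^ 2)) ?_ ?_
    (fun y => by simpa only [sub_le_iff_le_add] using P.merit_le_merit_add x y)
    (fun y => P.merit_le_merit_add y x)
  · exact (by fun_prop : Continuous _).tendsto' x _ (by simp)
  · exact (by fun_prop : Continuous _).tendsto' x _ (by simp)

lemma one_add_le_merit (x : E) : 1 + (P.f (P.proxPoint x) - P.fbar)
    + P.rate / 2 * ‖x - P.proxPoint x‖ ^ 2 ≤ P.merit x := by
  unfold merit
  linarith [P.le_toReal_φ (P.proxPoint_mem_effDom x)]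

lemma one_le_merit (x : E) : 1 ≤ P.merit x := by
  have hquad : 0 ≤ P.rate / 2 * ‖x - P.proxPoint x‖ ^ 2 := by
    have := P.rate_pos
    positivity
  linarith [P.one_add_le_merit x, P.le_f (P.proxPoint x)]

lemma merit_nonneg (x : E) : 0 ≤ P.merit x := zero_le_one.trans (P.one_le_merit x)

lemma norm_sub_proxPoint_sq_le_merit (x : E) : ‖x - P.proxPoint x‖ ^ 2 ≤ P.merit x := by
  have hrate : 1 ≤ P.rate / 2 := by
    unfold rate
    linarith [P.τ_nonneg, P.L.coe_nonneg]
  linarith [P.one_add_le_merit x, P.le_f (P.proxPoint x),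
    le_mul_of_one_le_left (sq_nonneg ‖x - P.proxPoint x‖) hrate]

lemma f_sub_le_merit (x : E) : P.f x - P.fbar ≤ 2 * P.merit x := by
  have hrate : P.L * ‖x - P.proxPoint x‖ ^ 2 ≤ P.rate * ‖x - P.proxPoint x‖ ^ 2 := by
    gcongr
    unfold rate
    linarith [P.τ_nonneg]
  linarith [P.one_add_le_merit x, sub_le_two_mul_sub_add_norm_sq P.differentiable
    P.lipschitz_gradient P.le_f (P.proxPoint x) x]

lemma norm_gradient_sq_le_merit (x : E) : ‖gradient P.f x‖ ^ 2 ≤ 4 * P.L * P.merit x := by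
  refine (norm_gradient_sq_le P.differentiable P.lipschitz_gradient P.le_f x).trans ?_
  nlinarith [P.f_sub_le_merit x, P.L.coe_nonneg]

theorem ofReal_merit_le_moreauEnv {θ : ℝ} (hθ : 0 < θ) (x : E) :
    ENNReal.ofReal (P.merit x) ≤ ENNReal.ofReal (1 + P.rate * θ) *
      ((moreauEnv θ P.objective x).toENNReal + ENNReal.ofReal (1 - (P.fbar + P.φbar))) := by
  set c := 1 + P.rate * θ with hc_def
  have hc : 1 ≤ c := le_add_of_nonneg_right (mul_pos P.rate_pos hθ).le
  have hle : ((P.merit x / c - (1 - (P.fbar + P.φbar)) : ℝ) : EReal)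
      ≤ moreauEnv θ P.objective x := by
    refine le_iInf fun y => ?_
    by_cases hy : y ∈ effDom P.φ
    swap
    · have htop : P.φ y = ⊤ := not_lt_top_iff.1 hy
      simp [proxObj, objective, htop]
    rw [proxObj, objective, ← EReal.coe_toReal (ne_of_lt hy) (P.weaklyConvex.1 y),
      ← EReal.coe_add, ← EReal.coe_add, EReal.coe_le_coe_iff, sub_le_iff_le_add,
      div_le_iff₀ (by positivity)]
    have hval : 0 ≤ P.rate * θ * (P.f y + (P.φ y).toReal - (P.fbar + P.φbar) + 1) :=
      mul_nonneg (by linarith) (by linarith [P.le_f y, P.le_toReal_φ hy])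
    have hquad : P.rate / 2 * ‖x - y‖ ^ 2 ≤ ‖x - y‖ ^ 2 / (2 * θ) * c := by
      rw [hc_def, mul_add, ← sub_nonneg]
      have : 0 ≤ ‖x - y‖ ^ 2 / (2 * θ) := by positivity
      convert this using 1
      field_simp
      ring
    linarith [P.merit_le x hy]
  have hofReal := EReal.toENNReal_le_toENNReal hle
  rw [EReal.toENNReal_of_ne_top (EReal.coe_ne_top _), EReal.toReal_coe] at hofReal
  calc ENNReal.ofReal (P.merit x) = ENNReal.ofReal c * ENNReal.ofReal
        (P.merit x / c - (1 - (P.fbar + P.φbar)) + (1 - (P.fbar + P.φbar))) := by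
        rw [← ENNReal.ofReal_mul (by positivity), sub_add_cancel, mul_div_cancel₀]
        positivity
    _ ≤ _ := by gcongr; exact ENNReal.ofReal_add_le.trans (add_le_add hofReal le_rfl)

lemma proxStep_add_le {α : ℝ} (hα : 0 < α) {x x' g y : E}
    (hx' : x' ∈ proxSet α P.φ (x - α • g)) (hy : y ∈ effDom P.φ) :
    2 * α * ((P.φ x').toReal - (P.φ y).toReal) + ‖x - x'‖ ^ 2 + (1 - α * P.τ) * ‖x' - y‖ ^ 2
      ≤ ‖x - y‖ ^ 2 + 2 * α * inner ℝ g (y - x') := by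
  have hsub := (P.weaklyConvex.isWeakSubgradient_of_mem_proxSet P.nonempty hx').add_inner_sub_le
    y hy
  have hexpand := norm_sub_sq_real (x - x') (y - x')
  have hinner : α * inner ℝ (α⁻¹ • (x - α • g - x')) (y - x')
      = inner ℝ (x - x') (y - x') - α * inner ℝ g (y - x') := by
    rw [real_inner_smul_left, mul_inv_cancel_left₀ hα.ne', sub_right_comm, inner_sub_left,
      real_inner_smul_left]
  rw [sub_sub_sub_cancel_right] at hexpand
  have hscaled := mul_le_mul_of_nonneg_left hsub (by positivity : 0 ≤ 2 * α)
  rw [norm_sub_rev x' y]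
  linarith

lemma mem_effDom_of_step {α : ℝ} {z x' : E} (hx' : x' ∈ proxSet α P.φ z) : x' ∈ effDom P.φ :=
  (P.weaklyConvex.isWeakSubgradient_of_mem_proxSet P.nonempty hx').mem_effDom

theorem norm_sub_proxPoint_sq_le_of_step {α : ℝ} (hα : 0 < α) (hα' : α * (P.rate + P.L) ≤ 1 / 2)
    {x x' g : E} (hx' : x' ∈ proxSet α P.φ (x - α • g)) :
    ‖x' - P.proxPoint x‖ ^ 2 ≤ (1 - 2 * α) * ‖x - P.proxPoint x‖ ^ 2
      + 2 * α * inner ℝ (P.proxPoint x - x) (g - gradient P.f x)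
      + 2 * α ^ 2 * ‖g - gradient P.f x‖ ^ 2 := by
  set p := P.proxPoint x with hp
  set e := g - gradient P.f x with he
  have hprox := P.proxStep_add_le hα hx' (P.proxPoint_mem_effDom x)
  have hdescent (y : E) := mul_le_mul_of_nonneg_left
    (abs_sub_sub_inner_gradient_le P.differentiable P.lipschitz_gradient x y) hα.le
  have hsmooth_x' := le_trans (mul_le_mul_of_nonneg_left (le_abs_self _) hα.le) (hdescent x')
  have hsmooth_p := le_trans (mul_le_mul_of_nonneg_left (neg_le_abs _) hα.le) (hdescent p)
  have hgrowth := mul_le_mul_of_nonneg_left (P.merit_add_le x (P.mem_effDom_of_step hx')) hα.le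
  have hinner : inner ℝ g (p - x') = inner ℝ (gradient P.f x) (p - x)
      - inner ℝ (gradient P.f x) (x' - x) + inner ℝ (p - x) e + inner ℝ e (x - x') := by
    rw [real_inner_comm e (p - x)]
    simp only [he, inner_sub_left, inner_sub_right]
    ring
  have hyoung : 2 * α * inner ℝ e (x - x') ≤ 2 * α ^ 2 * ‖e‖ ^ 2 + 1 / 2 * ‖x - x'‖ ^ 2 := by
    nlinarith [real_inner_le_norm e (x - x'), sq_nonneg (2 * α * ‖e‖ - ‖x - x'‖)]
  have hslack : 0 ≤ (1 / 2 - α * (P.rate + P.L)) * ‖x - x'‖ ^ 2 :=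
    mul_nonneg (by linarith) (sq_nonneg _)
  have hτ := P.τ_nonneg
  have hdrop : 0 ≤ 2 * α * P.τ * ‖x - p‖ ^ 2 + 2 * α * ‖x' - p‖ ^ 2 := by positivity
  rw [norm_sub_rev x' x] at hsmooth_x'
  rw [norm_sub_rev p x] at hsmooth_p
  rw [merit, ← hp] at hgrowth
  rw [hinner] at hprox
  unfold rate at *
  linarith

theorem merit_le_of_step {α : ℝ} (hα : 0 < α) (hα' : α * (P.rate + P.L) ≤ 1 / 2) {x x' g : E}
    (hx' : x' ∈ proxSet α P.φ (x - α • g)) :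
    P.merit x' ≤ P.merit x - P.rate * α * ‖x - P.proxPoint x‖ ^ 2
      + P.rate * α * inner ℝ (P.proxPoint x - x) (g - gradient P.f x)
      + P.rate * α ^ 2 * ‖g - gradient P.f x‖ ^ 2 := by
  have hmerit := P.merit_le_merit_add x' x
  have hstep := mul_le_mul_of_nonneg_left (P.norm_sub_proxPoint_sq_le_of_step hα hα' hx')
    (half_pos P.rate_pos).le
  linarith

lemma merit_le_of_step_of_pos {α : ℝ} (hα : 0 < α) {x x' g : E}
    (hx' : x' ∈ proxSet α P.φ (x - α • g)) :
    P.merit x' ≤ (1 + P.rate * (4 + 2 * α)) * P.merit x + 4 * P.rate * α ^ 2 * ‖g‖ ^ 2 := by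
  set p := P.proxPoint x with hp
  set z := x - α • g with hz
  have hp_dom := P.proxPoint_mem_effDom x
  have hmin : ‖z - x'‖ ^ 2 / (2 * α) + (P.φ x').toReal
      ≤ ‖z - p‖ ^ 2 / (2 * α) + (P.φ p).toReal :=
    add_toReal_le_add_toReal (P.weaklyConvex.1 _) (P.weaklyConvex.1 _) hp_dom
      (by simpa only [proxObj_eq_coe_add] using hx' p)
  have hzx' : ‖z - x'‖ ^ 2 ≤ ‖z - p‖ ^ 2 + 2 * α * P.merit x := by
    have hrate := mul_nonneg P.rate_pos.le (sq_nonneg ‖x - p‖)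
    have hgap : (P.φ p).toReal - (P.φ x').toReal ≤ P.merit x := by
      rw [merit, ← hp]
      linarith [P.le_f p, P.le_toReal_φ (P.mem_effDom_of_step hx')]
    have := mul_le_mul_of_nonneg_left hgap (by positivity : 0 ≤ 2 * α)
    have hscaled : (‖z - x'‖ ^ 2 - ‖z - p‖ ^ 2) / (2 * α) ≤ P.merit x := by
      rw [sub_div]
      linarith
    rw [div_le_iff₀' (by positivity)] at hscaled
    linarith
  have hzp : ‖z - p‖ ^ 2 ≤ 2 * (‖x - p‖ ^ 2 + α ^ 2 * ‖g‖ ^ 2) := by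
    simpa only [hz, sub_right_comm, norm_smul, mul_pow, Real.norm_eq_abs, sq_abs]
      using norm_sub_sq_le_two_mul (x - p) (α • g)
  have hx'p : ‖x' - p‖ ^ 2 ≤ 2 * (‖z - p‖ ^ 2 + ‖z - x'‖ ^ 2) := by
    simpa only [sub_sub_sub_cancel_left] using norm_sub_sq_le_two_mul (z - p) (z - x')
  have hbound : ‖x' - p‖ ^ 2 - ‖x - p‖ ^ 2
      ≤ (8 + 4 * α) * P.merit x + 8 * α ^ 2 * ‖g‖ ^ 2 := by
    nlinarith [P.norm_sub_proxPoint_sq_le_merit x, sq_nonneg ‖x - p‖]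
  have hmerit := P.merit_le_merit_add x' x
  have hscaled := mul_le_mul_of_nonneg_left hbound (half_pos P.rate_pos).le
  linarith

lemma norm_step_le {α : ℝ} (hα : 0 < α) (hα' : α * P.τ ≤ 1) {x x' g : E}
    (hx : x ∈ effDom P.φ) (hx' : x' ∈ proxSet α P.φ (x - α • g)) :
    ‖x' - x‖ ≤ 2 * α * (|P.Lφ| + ‖g‖) := by
  have hprox := P.proxStep_add_le hα hx' hx
  have hlip : (P.φ x).toReal - (P.φ x').toReal ≤ |P.Lφ| * ‖x - x'‖ :=
    (P.sub_le_mul_norm x hx x' (P.mem_effDom_of_step hx')).trans (by gcongr; exact le_abs_self _)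
  have hcs := real_inner_le_norm g (x - x')
  have hcurv : 0 ≤ (1 - α * P.τ) * ‖x' - x‖ ^ 2 := mul_nonneg (by linarith) (sq_nonneg _)
  have hsq : ‖x - x'‖ * ‖x - x'‖ ≤ 2 * α * (|P.Lφ| + ‖g‖) * ‖x - x'‖ := by
    have := mul_le_mul_of_nonneg_left (add_le_add hlip hcs) (by positivity : 0 ≤ 2 * α)
    simp only [sub_self, norm_zero] at hprox
    linarith
  rw [norm_sub_rev]
  rcases (norm_nonneg (x - x')).eq_or_lt with h0 | hpos
  · rw [← h0]
    positivity
  · exact le_of_mul_le_mul_right hsq hpos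

lemma mul_τ_le_one {α : ℝ} (hα : 0 < α) (hα' : α * (P.rate + P.L) ≤ 1 / 2) : α * P.τ ≤ 1 := by
  have : α * P.τ ≤ α * (P.rate + P.L) := by
    gcongr
    unfold rate
    linarith [P.τ_nonneg, P.L.coe_nonneg]
  linarith

lemma norm_step_sq_le {α : ℝ} (hα : 0 < α) (hα' : α * P.τ ≤ 1) {x x' g : E}
    (hx : x ∈ effDom P.φ) (hx' : x' ∈ proxSet α P.φ (x - α • g)) :
    ‖x' - x‖ ^ 2 ≤ 8 * α ^ 2
      * ((P.Lφ ^ 2 + 8 * P.L) * P.merit x + 2 * ‖g - gradient P.f x‖ ^ 2) := by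
  have hg : ‖g‖ ^ 2 ≤ 2 * (‖g - gradient P.f x‖ ^ 2 + ‖gradient P.f x‖ ^ 2) := by
    simpa using norm_sub_sq_le_two_mul (g - gradient P.f x) (-gradient P.f x)
  have hmerit := mul_le_mul_of_nonneg_left (P.one_le_merit x) (sq_nonneg P.Lφ)
  calc ‖x' - x‖ ^ 2 ≤ (2 * α * (|P.Lφ| + ‖g‖)) ^ 2 := by
        gcongr
        exact P.norm_step_le hα hα' hx hx'
    _ = 4 * α ^ 2 * (|P.Lφ| + ‖g‖) ^ 2 := by ring
    _ ≤ 4 * α ^ 2 * (2 * (|P.Lφ| ^ 2 + ‖g‖ ^ 2)) := by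
        gcongr
        exact add_sq_le
    _ = 8 * α ^ 2 * (P.Lφ ^ 2 + ‖g‖ ^ 2) := by
        rw [sq_abs]
        ring
    _ ≤ _ := by
        refine mul_le_mul_of_nonneg_left ?_ (by positivity)
        linarith [P.norm_gradient_sq_le_merit x]

lemma norm_sub_proxPoint_sub_le (x y : E) :
    ‖x - P.proxPoint x‖ - ‖y - P.proxPoint y‖ ≤ (1 + P.rate) * ‖y - x‖ := by
  refine (norm_sub_norm_le _ _).trans ?_
  rw [sub_sub_sub_comm, norm_sub_rev y, add_mul, one_mul]
  exact (norm_sub_le _ _).trans (add_le_add le_rfl (P.norm_proxPoint_sub_le x y))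

lemma prox_mem_proxSet {lam : ℝ} (hlam : 0 < lam) (hlt : lam * P.τ < 1) (z : E) :
    prox lam P.φ z ∈ proxSet lam P.φ z :=
  P.weaklyConvex.prox_mem_proxSet P.nonempty P.lowerSemicontinuous P.le_φ hlam hlt z

lemma norm_gradient_sub_le (x y : E) : ‖gradient P.f x - gradient P.f y‖ ≤ P.L * ‖x - y‖ := by
  simpa only [dist_eq_norm] using P.lipschitz_gradient.dist_le_mul x y

lemma norm_natRes_sub_le {lam : ℝ} (hlam : 0 < lam) (hlt : lam * P.τ < 1) (x y : E) :
    ‖natRes lam P.f P.φ x - natRes lam P.f P.φ y‖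
      ≤ (1 + (lam⁻¹ + P.L) / (lam⁻¹ - P.τ)) * ‖x - y‖ := by
  have hgap : 0 < lam⁻¹ - P.τ := by rwa [sub_pos, inv_eq_one_div, lt_div_iff₀' hlam]
  unfold natRes
  set q := prox lam P.φ (x - lam • gradient P.f x)
  set q' := prox lam P.φ (y - lam • gradient P.f y)
  have hq := P.weaklyConvex.norm_sub_le_of_mem_proxSet P.nonempty
    (P.prox_mem_proxSet hlam hlt (x - lam • gradient P.f x))
    (P.prox_mem_proxSet hlam hlt (y - lam • gradient P.f y))
  have hstep : ‖lam⁻¹ • (x - lam • gradient P.f x - (y - lam • gradient P.f y))‖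
      ≤ (lam⁻¹ + P.L) * ‖x - y‖ := by
    rw [sub_sub_sub_comm, ← smul_sub, smul_sub lam⁻¹, inv_smul_smul₀ hlam.ne', add_mul]
    refine (norm_sub_le _ _).trans (add_le_add ?_ (P.norm_gradient_sub_le x y))
    rw [norm_smul, Real.norm_of_nonneg (inv_pos.2 hlam).le]
  rw [sub_sub_sub_comm, add_mul, one_mul, div_mul_eq_mul_div]
  refine (norm_sub_le _ _).trans (add_le_add le_rfl ?_)
  rw [le_div_iff₀' hgap]
  exact hq.trans hstep

lemma continuous_natRes {lam : ℝ} (hlam : 0 < lam) (hlt : lam * P.τ < 1) :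
    Continuous (natRes lam P.f P.φ) :=
  (LipschitzWith.of_dist_le' fun x y => by
    simpa only [dist_eq_norm] using P.norm_natRes_sub_le hlam hlt x y).continuous

theorem norm_natRes_le {lam : ℝ} (hlam : 0 < lam) (hlt : lam * P.τ < 1) (x : E) :
    ‖natRes lam P.f P.φ x‖
      ≤ (1 + (P.rate + P.L + lam⁻¹) / (lam⁻¹ - P.τ)) * ‖x - P.proxPoint x‖ := by
  have hgap : 0 < lam⁻¹ - P.τ := by rwa [sub_pos, inv_eq_one_div, lt_div_iff₀' hlam]
  set p := P.proxPoint x with hp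
  unfold natRes
  set q := prox lam P.φ (x - lam • gradient P.f x)
  have hp_sub := P.weaklyConvex.isWeakSubgradient_of_mem_proxSet_coe_add P.nonempty
    (P.differentiable _) (P.proxPoint_mem_proxSet x)
  have hq_sub := P.weaklyConvex.isWeakSubgradient_of_mem_proxSet P.nonempty
    (P.prox_mem_proxSet hlam hlt (x - lam • gradient P.f x))
  have hpq := hp_sub.norm_sub_le (c := lam⁻¹)
    (a := P.rate • (x - p) + (gradient P.f x - gradient P.f p) - lam⁻¹ • (x - p)) hq_sub (by
      rw [← hp, inv_inv, sub_right_comm x, smul_sub _ (x - q), inv_smul_smul₀ hlam.ne']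
      module)
  have hstep : ‖P.rate • (x - p) + (gradient P.f x - gradient P.f p) - lam⁻¹ • (x - p)‖
      ≤ (P.rate + P.L + lam⁻¹) * ‖x - p‖ := by
    rw [add_mul, add_mul]
    refine (norm_sub_le _ _).trans (add_le_add ((norm_add_le _ _).trans (add_le_add ?_ ?_)) ?_)
    · rw [norm_smul, Real.norm_of_nonneg P.rate_pos.le]
    · exact P.norm_gradient_sub_le x p
    · rw [norm_smul, Real.norm_of_nonneg (inv_pos.2 hlam).le]
  rw [add_mul, one_mul, div_mul_eq_mul_div]
  refine (norm_sub_le_norm_sub_add_norm_sub x p q).trans (add_le_add le_rfl ?_)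
  rw [le_div_iff₀' hgap]
  exact hpq.trans hstep

end CompositeProblem

end CompositeProblem

section SummableMulSq

variable {G α M : ℕ → ℝ} {H : ℝ}

lemma exists_add_lt_of_summable_mul_sq (hα : ∀ k, 0 ≤ α k) (hα' : ¬ Summable α)
    (hsum : Summable fun k => α k * G k ^ 2) {c : ℝ} (hc : 0 < c) (n : ℕ) :
    ∃ j, G (n + j) < c := by
  by_contra! hle
  refine hα' ((summable_nat_add_iff n).1 (((summable_nat_add_iff n).2 hsum).mul_left (c ^ 2)⁻¹
    |>.of_nonneg_of_le (fun k => hα _) fun k => ?_))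
  rw [le_inv_mul_iff₀' (by positivity)]
  have := hle k
  rw [add_comm n k] at this
  gcongr
  exact hα _

lemma sub_le_mul_sum_add_sub (hstep : ∀ k, G k - G (k + 1) ≤ H * α k + (M (k + 1) - M k))
    (n j : ℕ) :
    G n - G (n + j) ≤ H * ∑ i ∈ Finset.range j, α (n + i) + (M (n + j) - M n) := by
  induction j with
  | zero => simp
  | succ j ih =>
    rw [Finset.sum_range_succ, ← add_assoc]
    linarith [hstep (n + j)]

theorem tendsto_zero_of_summable_mul_sq (hα : ∀ k, 0 ≤ α k) (hα' : ¬ Summable α)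
    (hsum : Summable fun k => α k * G k ^ 2) (hG : ∀ k, 0 ≤ G k) (hH : 0 ≤ H)
    (hstep : ∀ k, G k - G (k + 1) ≤ H * α k + (M (k + 1) - M k)) (hM : CauchySeq M) :
    Tendsto G atTop (𝓝 0) := by
  refine tendsto_order.2 ⟨fun c hc => .of_forall fun k => hc.trans_le (hG k), fun η hη => ?_⟩
  set δ := η ^ 3 / (16 * (H + 1)) with hδ
  obtain ⟨N₁, hN₁⟩ := Metric.cauchySeq_iff.1 hM (η / 4) (by positivity)
  obtain ⟨N₂, hN₂⟩ := Metric.cauchySeq_iff.1 hsum.hasSum.tendsto_sum_nat.cauchySeq δ (by positivity)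
  filter_upwards [eventually_ge_atTop (max N₁ N₂)] with n hn
  have hexists := exists_add_lt_of_summable_mul_sq hα hα' hsum (half_pos hη) n
  set j := Nat.find hexists
  have hM_lt := (le_abs_self _).trans_lt (hN₁ (n + j) (by omega) n (by omega))
  have htail := (le_abs_self _).trans_lt (hN₂ (n + j) (by omega) n (by omega))
  rw [Finset.sum_range_add, add_sub_cancel_left] at htail
  have hsum_le : (η / 2) ^ 2 * ∑ i ∈ Finset.range j, α (n + i) ≤ δ := by
    refine le_trans ?_ htail.le
    rw [Finset.mul_sum]
    refine Finset.sum_le_sum fun i hi => ?_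
    have hge : η / 2 ≤ G (n + i) := not_lt.1 (Nat.find_min hexists (Finset.mem_range.1 hi))
    rw [mul_comm]
    gcongr
    exact hα _
  have hdrift : H * ∑ i ∈ Finset.range j, α (n + i) ≤ η / 4 := by
    have hsum_nonneg : 0 ≤ ∑ i ∈ Finset.range j, α (n + i) := Finset.sum_nonneg fun i _ => hα _
    rw [hδ, le_div_iff₀ (by positivity)] at hsum_le
    rw [← mul_le_mul_iff_right₀ (pow_pos hη 2)]
    nlinarith [mul_nonneg (sq_nonneg η) hsum_nonneg]
  linarith [sub_le_mul_sum_add_sub hstep n j, Nat.find_spec hexists]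

end SummableMulSq

section RobbinsSiegmund

variable {a b r : ℕ → ℝ}

lemma prod_one_add_le_exp_tsum (hb : ∀ k, 0 ≤ b k) (hsum : Summable b) (n : ℕ) :
    ∏ i ∈ Finset.range n, (1 + b i) ≤ Real.exp (∑' k, b k) :=
  (Real.prod_one_add_le_exp_sum _ fun i => hb i).trans
    (Real.exp_le_exp.2 (hsum.sum_le_tsum _ fun i _ => hb i))

lemma bddAbove_range_of_le_one_add_mul (ha : ∀ k, 0 ≤ a k) (hb : ∀ k, 0 ≤ b k) (hsum : Summable b)
    (hstep : ∀ k, a (k + 1) ≤ (1 + b k) * a k) : BddAbove (Set.range a) := by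
  have hprod (n : ℕ) : a n ≤ (∏ i ∈ Finset.range n, (1 + b i)) * a 0 := by
    induction n with
    | zero => simp
    | succ n ih =>
      rw [Finset.prod_range_succ_comm, mul_assoc]
      exact (hstep n).trans (mul_le_mul_of_nonneg_left ih (by linarith [hb n]))
  refine ⟨Real.exp (∑' k, b k) * a 0, ?_⟩
  rintro _ ⟨n, rfl⟩
  exact (hprod n).trans (mul_le_mul_of_nonneg_right (prod_one_add_le_exp_tsum hb hsum n) (ha 0))

lemma summable_of_le_one_add_mul_sub (ha : ∀ k, 0 ≤ a k) (hr : ∀ k, 0 ≤ r k) (hb : ∀ k, 0 ≤ b k)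
    (hsum : Summable b) (hstep : ∀ k, a (k + 1) ≤ (1 + b k) * a k - r k) : Summable r := by
  obtain ⟨c, hc⟩ := bddAbove_range_of_le_one_add_mul ha hb hsum
    fun k => (hstep k).trans (sub_le_self _ (hr k))
  have hle (k : ℕ) : r k ≤ (a k - a (k + 1)) + b k * c := by
    have := mul_le_mul_of_nonneg_left (hc ⟨k, rfl⟩) (hb k)
    linarith [hstep k]
  refine summable_of_sum_range_le (c := a 0 + (∑' k, b k) * c) hr fun n => ?_
  refine (Finset.sum_le_sum fun k _ => hle k).trans ?_
  rw [Finset.sum_add_distrib, Finset.sum_range_sub', ← Finset.sum_mul]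
  have hc₀ : 0 ≤ c := (ha 0).trans (hc ⟨0, rfl⟩)
  have := mul_le_mul_of_nonneg_right (hsum.sum_le_tsum (Finset.range n) fun i _ => hb i) hc₀
  linarith [ha n]

variable {Ω : Type*} {mΩ : MeasurableSpace Ω} {ν : Measure Ω} {ℱ : Filtration ℕ mΩ}
  {W R Y : ℕ → Ω → ℝ}

lemma ae_summable_of_summable_integral (hR : ∀ k ω, 0 ≤ R k ω) (hint : ∀ k, Integrable (R k) ν)
    (hsum : Summable fun k => ∫ ω, R k ω ∂ν) : ∀ᵐ ω ∂ν, Summable fun k => R k ω := by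
  have hmeas (k : ℕ) : AEMeasurable (fun ω => ENNReal.ofReal (R k ω)) ν :=
    (hint k).aemeasurable.ennreal_ofReal
  have hne : ∫⁻ ω, ∑' k, ENNReal.ofReal (R k ω) ∂ν ≠ ⊤ := by
    simp_rw [lintegral_tsum hmeas,
      ← ofReal_integral_eq_lintegral_ofReal (hint _) (ae_of_all _ (hR _))]
    exact hsum.tsum_ofReal_ne_top
  filter_upwards [ae_lt_top' (AEMeasurable.tsum hmeas) hne] with ω hω
  simpa only [ENNReal.toReal_ofReal (hR _ ω)] using ENNReal.summable_toReal hω.ne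

variable [IsFiniteMeasure ν]

lemma ae_bddAbove_range_of_supermartingale (hY : Supermartingale Y ℱ ν) (hnn : ∀ k ω, 0 ≤ Y k ω) :
    ∀ᵐ ω ∂ν, BddAbove (Set.range fun k => Y k ω) := by
  have hbdd (k : ℕ) : eLpNorm ((-Y) k) 1 ν ≤ (∫ ω, Y 0 ω ∂ν).toNNReal := by
    rw [Pi.neg_apply, eLpNorm_neg, eLpNorm_one_eq_lintegral_enorm,
      ← ofReal_integral_norm_eq_lintegral_enorm (hY.integrable k)]
    refine ENNReal.ofReal_le_ofReal ?_
    simp_rw [Real.norm_of_nonneg (hnn k _)]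
    simpa only [setIntegral_univ] using hY.setIntegral_le k.zero_le MeasurableSet.univ
  filter_upwards [hY.neg.exists_ae_tendsto_of_bdd hbdd] with ω ⟨c, hc⟩
  simpa using hc.neg.bddAbove_range

lemma integral_le_of_condExp_le {m : MeasurableSpace Ω} (hm : m ≤ mΩ) {X Z : Ω → ℝ}
    (hZ : Integrable Z ν) (hXZ : ν[X | m] ≤ᵐ[ν] Z) : ∫ ω, X ω ∂ν ≤ ∫ ω, Z ω ∂ν := by
  rw [← integral_condExp hm]
  exact integral_mono_ae integrable_condExp hZ hXZ

section

variable (hb : ∀ k, 0 ≤ b k) (hsum : Summable b) (hW : ∀ k ω, 0 ≤ W k ω)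
  (hint : ∀ k, Integrable (W k) ν)
include hb hsum hW hint

theorem ae_bddAbove_range_of_condExp_le (hadapted : StronglyAdapted ℱ W)
    (hstep : ∀ k, ν[W (k + 1) | ℱ k] ≤ᵐ[ν] fun ω => (1 + b k) * W k ω) :
    ∀ᵐ ω ∂ν, BddAbove (Set.range fun k => W k ω) := by
  set β : ℕ → ℝ := fun k => ∏ i ∈ Finset.range k, (1 + b i)
  have hβ (k : ℕ) : 0 < β k := Finset.prod_pos fun i _ => by linarith [hb i]
  have hsuper : Supermartingale (fun k => (β k)⁻¹ • W k) ℱ ν := by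
    refine supermartingale_nat (fun k => (hadapted k).const_smul _) (fun k => (hint k).smul _)
      fun k => ?_
    filter_upwards [condExp_smul (β (k + 1))⁻¹ (W (k + 1)) (ℱ k), hstep k] with ω hsmul hω
    have hβ_succ : β (k + 1) = (1 + b k) * β k := Finset.prod_range_succ_comm _ _
    rw [hsmul, Pi.smul_apply, Pi.smul_apply, smul_eq_mul, smul_eq_mul, inv_mul_le_iff₀ (hβ _),
      hβ_succ, mul_assoc, mul_inv_cancel_left₀ (hβ k).ne']
    exact hω
  filter_upwards [ae_bddAbove_range_of_supermartingale hsuper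
    fun k ω => mul_nonneg (inv_nonneg.2 (hβ k).le) (hW k ω)] with ω ⟨c, hc⟩
  refine ⟨Real.exp (∑' k, b k) * c, ?_⟩
  rintro _ ⟨k, rfl⟩
  have hck : (β k)⁻¹ * W k ω ≤ c := hc ⟨k, rfl⟩
  have hc₀ : 0 ≤ c := (mul_nonneg (inv_nonneg.2 (hβ k).le) (hW k ω)).trans hck
  exact ((inv_mul_le_iff₀ (hβ k)).1 hck).trans
    (mul_le_mul_of_nonneg_right (prod_one_add_le_exp_tsum hb hsum k) hc₀)

theorem bddAbove_range_integral_of_condExp_le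
    (hstep : ∀ k, ν[W (k + 1) | ℱ k] ≤ᵐ[ν] fun ω => (1 + b k) * W k ω) :
    BddAbove (Set.range fun k => ∫ ω, W k ω ∂ν) := by
  refine bddAbove_range_of_le_one_add_mul (fun k => integral_nonneg (hW k)) hb hsum fun k => ?_
  rw [← integral_const_mul]
  exact integral_le_of_condExp_le (ℱ.le k) ((hint k).const_mul _) (hstep k)

theorem summable_integral_of_condExp_le (hR : ∀ k ω, 0 ≤ R k ω) (hRint : ∀ k, Integrable (R k) ν)
    (hstep : ∀ k, ν[W (k + 1) | ℱ k] ≤ᵐ[ν] fun ω => (1 + b k) * W k ω - R k ω) :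
    Summable fun k => ∫ ω, R k ω ∂ν := by
  refine summable_of_le_one_add_mul_sub (fun k => integral_nonneg (μ := ν) (hW k))
    (fun k => integral_nonneg (hR k)) hb hsum fun k => ?_
  rw [← integral_const_mul, ← integral_sub ((hint k).const_mul _) (hRint k)]
  exact integral_le_of_condExp_le (ℱ.le k) (((hint k).const_mul _).sub (hRint k)) (hstep k)

end

end RobbinsSiegmund

section MartingaleSums

variable {Ω : Type*} {m mΩ : MeasurableSpace Ω} {ν : Measure Ω}

lemma condExp_inner_eq_zero {E : Type*} [NormedAddCommGroup E] [InnerProductSpace ℝ E]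
    [CompleteSpace E] {u e : Ω → E} (hu : StronglyMeasurable[m] u) (he : Integrable e ν)
    (hint : Integrable (fun ω => inner ℝ (u ω) (e ω)) ν) (hzero : ν[e | m] =ᵐ[ν] 0) :
    ν[fun ω => inner ℝ (u ω) (e ω) | m] =ᵐ[ν] 0 := by
  filter_upwards [condExp_bilin_of_stronglyMeasurable_left (innerSL ℝ (E := E)) hu hint he, hzero]
    with ω hpull hω
  exact hpull.trans (by simp [hω])

lemma integral_add_sq_of_condExp_eq_zero (hm : m ≤ mΩ) [SigmaFinite (ν.trim hm)] {u d : Ω → ℝ}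
    (hu : StronglyMeasurable[m] u) (hu₂ : MemLp u 2 ν) (hd : MemLp d 2 ν) (hd₁ : Integrable d ν)
    (hzero : ν[d | m] =ᵐ[ν] 0) :
    ∫ ω, (u ω + d ω) ^ 2 ∂ν = ∫ ω, u ω ^ 2 ∂ν + ∫ ω, d ω ^ 2 ∂ν := by
  have hint : Integrable (fun ω => inner ℝ (u ω) (d ω)) ν := hd.integrable_mul hu₂
  have horth : ∫ ω, inner ℝ (u ω) (d ω) ∂ν = 0 := by
    rw [← integral_condExp hm, integral_congr_ae (condExp_inner_eq_zero hu hd₁ hint hzero)]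
    simp
  have hexpand (ω : Ω) : (u ω + d ω) ^ 2 = u ω ^ 2 + d ω ^ 2 + 2 * inner ℝ (u ω) (d ω) := by
    rw [real_inner_eq_re_inner]
    simp
    ring
  have hsq : Integrable (fun ω => u ω ^ 2 + d ω ^ 2) ν := hu₂.integrable_sq.add hd.integrable_sq
  simp_rw [hexpand]
  rw [integral_add hsq (hint.const_mul 2), integral_add hu₂.integrable_sq hd.integrable_sq,
    integral_const_mul, horth, mul_zero, add_zero]

variable [IsFiniteMeasure ν]

lemma integral_abs_le_measureReal_univ_add_integral_sq {X : Ω → ℝ} (hX : MemLp X 2 ν) :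
    ∫ ω, |X ω| ∂ν ≤ ν.real Set.univ + ∫ ω, X ω ^ 2 ∂ν := by
  have hle (ω : Ω) : |X ω| ≤ 1 + X ω ^ 2 := by nlinarith [sq_abs (X ω), sq_nonneg (|X ω| - 1)]
  refine (integral_mono (hX.integrable one_le_two).abs
    ((integrable_const 1).add hX.integrable_sq) hle).trans_eq ?_
  simp [integral_add (integrable_const 1) hX.integrable_sq]

variable {ℱ : Filtration ℕ mΩ} {d : ℕ → Ω → ℝ}

lemma martingale_sum_range (hadapted : ∀ k, StronglyMeasurable[ℱ (k + 1)] (d k))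
    (hint : ∀ k, Integrable (d k) ν) (hzero : ∀ k, ν[d k | ℱ k] =ᵐ[ν] 0) :
    Martingale (fun n => ∑ i ∈ Finset.range n, d i) ℱ ν := by
  have hsum_adapted : StronglyAdapted ℱ fun n => ∑ i ∈ Finset.range n, d i := fun n =>
    Finset.stronglyMeasurable_sum _ fun i hi => (hadapted i).mono (ℱ.mono (Finset.mem_range.1 hi))
  have hsum_int (n : ℕ) : Integrable (∑ i ∈ Finset.range n, d i) ν :=
    integrable_finsetSum' _ fun i _ => hint i
  refine martingale_nat hsum_adapted hsum_int fun n => ?_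
  rw [Finset.sum_range_succ]
  filter_upwards [condExp_add (hsum_int n) (hint n) (ℱ n), hzero n] with ω hadd hω
  rw [hadd, condExp_of_stronglyMeasurable (ℱ.le n) (hsum_adapted n) (hsum_int n)]
  simp [hω]

theorem exists_ae_tendsto_sum_range (hadapted : ∀ k, StronglyMeasurable[ℱ (k + 1)] (d k))
    (hd : ∀ k, MemLp (d k) 2 ν) (hzero : ∀ k, ν[d k | ℱ k] =ᵐ[ν] 0)
    (hsum : Summable fun k => ∫ ω, d k ω ^ 2 ∂ν) :
    ∀ᵐ ω ∂ν, ∃ c, Tendsto (fun n => ∑ i ∈ Finset.range n, d i ω) atTop (𝓝 c) := by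
  have hint (k : ℕ) : Integrable (d k) ν := (hd k).integrable one_le_two
  have hM := martingale_sum_range hadapted hint hzero
  have hM₂ (n : ℕ) : MemLp (∑ i ∈ Finset.range n, d i) 2 ν := memLp_finsetSum' _ fun i _ => hd i
  have hsq (n : ℕ) : ∫ ω, (∑ i ∈ Finset.range n, d i) ω ^ 2 ∂ν =
      ∑ i ∈ Finset.range n, ∫ ω, d i ω ^ 2 ∂ν := by
    induction n with
    | zero => simp
    | succ n ih =>
      rw [Finset.sum_range_succ, Finset.sum_range_succ, ← ih]
      exact integral_add_sq_of_condExp_eq_zero (ℱ.le n) (hM.stronglyAdapted n) (hM₂ n) (hd n)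
        (hint n) (hzero n)
  have hbdd (n : ℕ) : eLpNorm (∑ i ∈ Finset.range n, d i) 1 ν ≤
      (ν.real Set.univ + ∑' k, ∫ ω, d k ω ^ 2 ∂ν).toNNReal := by
    rw [eLpNorm_one_eq_lintegral_enorm, ← ofReal_integral_norm_eq_lintegral_enorm (hM.integrable n)]
    refine ENNReal.ofReal_le_ofReal ((integral_abs_le_measureReal_univ_add_integral_sq
      (hM₂ n)).trans ?_)
    rw [hsq]
    gcongr
    exact hsum.sum_le_tsum _ fun k _ => integral_nonneg fun ω => sq_nonneg (d k ω)
  simpa only [Finset.sum_apply] using hM.submartingale.exists_ae_tendsto_of_bdd hbdd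

end MartingaleSums

section Compensator

variable {Ω : Type*} {m mΩ : MeasurableSpace Ω} {ν : Measure Ω} [IsFiniteMeasure ν] {X : Ω → ℝ}

lemma sq_integral_le_measureReal_univ_mul (hX : MemLp X 2 ν) :
    (∫ ω, X ω ∂ν) ^ 2 ≤ ν.real Set.univ * ∫ ω, X ω ^ 2 ∂ν := by
  have hint : Integrable X ν := hX.integrable one_le_two
  have hdiscrim := discrim_le_zero (a := ν.real Set.univ) (b := 2 * ∫ ω, X ω ∂ν)
    (c := ∫ ω, X ω ^ 2 ∂ν) fun t => by
      have hexpand : ∫ ω, (t + X ω) ^ 2 ∂ν =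
          ν.real Set.univ * (t * t) + 2 * (∫ ω, X ω ∂ν) * t + ∫ ω, X ω ^ 2 ∂ν := by
        have hlin : Integrable (fun ω => t ^ 2 + 2 * t * X ω) ν :=
          (integrable_const _).add (hint.const_mul _)
        simp_rw [add_sq]
        rw [integral_add hlin hX.integrable_sq,
          integral_add (integrable_const _) (hint.const_mul _), integral_const_mul, integral_const,
          smul_eq_mul]
        ring
      exact hexpand ▸ integral_nonneg fun ω => sq_nonneg _
  rw [discrim] at hdiscrim
  linarith

lemma sq_condExp_ae_le (hm : m ≤ mΩ) (hX : MemLp X 2 ν) :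
    ∀ᵐ ω ∂ν, (ν[X | m] ω) ^ 2 ≤ (ν[X ^ 2 | m]) ω := by
  have hcondVar : 0 ≤ᵐ[ν] Var[X; ν | m] := condExp_nonneg (ae_of_all _ fun ω => sq_nonneg _)
  filter_upwards [condVar_ae_eq_condExp_sq_sub_sq_condExp hm hX, hcondVar] with ω heq hnn
  rw [heq] at hnn
  exact sub_nonneg.1 hnn

lemma integral_sub_condExp_sq_le (hm : m ≤ mΩ) (hX : MemLp X 2 ν) :
    ∫ ω, (X ω - ν[X | m] ω) ^ 2 ∂ν ≤ ∫ ω, X ω ^ 2 ∂ν :=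
  calc ∫ ω, (X ω - ν[X | m] ω) ^ 2 ∂ν = ∫ ω, (Var[X; ν | m]) ω ∂ν := (integral_condExp hm).symm
    _ ≤ ∫ ω, (ν[X ^ 2 | m]) ω ∂ν :=
      integral_mono_ae integrable_condVar integrable_condExp (condVar_ae_le_condExp_sq hm hX)
    _ = ∫ ω, X ω ^ 2 ∂ν := integral_condExp hm

theorem exists_ae_tendsto_sum_range_sub_condExp {ℱ : Filtration ℕ mΩ} {Δ : ℕ → Ω → ℝ}
    (hadapted : ∀ k, StronglyMeasurable[ℱ (k + 1)] (Δ k)) (hΔ : ∀ k, MemLp (Δ k) 2 ν)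
    (hsum : Summable fun k => ∫ ω, Δ k ω ^ 2 ∂ν) :
    ∀ᵐ ω ∂ν, ∃ c, Tendsto (fun n => ∑ i ∈ Finset.range n, (Δ i ω - ν[Δ i | ℱ i] ω))
      atTop (𝓝 c) := by
  refine exists_ae_tendsto_sum_range (d := fun k => Δ k - ν[Δ k | ℱ k])
    (fun k => (hadapted k).sub (stronglyMeasurable_condExp.mono (ℱ.mono k.le_succ)))
    (fun k => (hΔ k).sub ((hΔ k).condExp one_le_two)) (fun k => ?_)
    (hsum.of_nonneg_of_le (fun k => integral_nonneg fun ω => sq_nonneg _)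
      fun k => integral_sub_condExp_sq_le (ℱ.le k) (hΔ k))
  refine (condExp_sub ((hΔ k).integrable one_le_two) integrable_condExp _).trans ?_
  rw [condExp_of_stronglyMeasurable (ℱ.le k) stronglyMeasurable_condExp integrable_condExp,
    sub_self]

end Compensator

/-- A nonnegative residual `G` whose squares are paid for, up to summable relative errors `b`, by
the conditional decrease of a Lyapunov process `W`, and whose decrements are bounded by a process
`Δ` with conditional second moments of order `α² W`. -/
structure IsStochasticDescent {Ω : Type*} {mΩ : MeasurableSpace Ω} (ν : Measure Ω)
    (ℱ : Filtration ℕ mΩ) (α b : ℕ → ℝ) (ρ κ : ℝ) (W G Δ : ℕ → Ω → ℝ) : Prop where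
  step_nonneg : ∀ k, 0 ≤ α k
  not_summable : ¬ Summable α
  summable_sq : Summable fun k => α k ^ 2
  error_nonneg : ∀ k, 0 ≤ b k
  summable_error : Summable b
  rho_pos : 0 < ρ
  kappa_nonneg : 0 ≤ κ
  lyapunov_nonneg : ∀ k ω, 0 ≤ W k ω
  lyapunov_adapted : StronglyAdapted ℱ W
  lyapunov_integrable : ∀ k, Integrable (W k) ν
  residual_nonneg : ∀ k ω, 0 ≤ G k ω
  residual_memLp : ∀ k, MemLp (G k) 2 ν
  bound_adapted : ∀ k, StronglyMeasurable[ℱ (k + 1)] (Δ k)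
  bound_memLp : ∀ k, MemLp (Δ k) 2 ν
  condExp_lyapunov_le :
    ∀ k, ν[W (k + 1) | ℱ k] ≤ᵐ[ν] fun ω => (1 + b k) * W k ω - ρ * (α k * G k ω ^ 2)
  residual_sub_le : ∀ k, ∀ᵐ ω ∂ν, G k ω - G (k + 1) ω ≤ Δ k ω
  condExp_bound_sq_le : ∀ k, ν[Δ k ^ 2 | ℱ k] ≤ᵐ[ν] fun ω => κ * α k ^ 2 * W k ω

namespace IsStochasticDescent

variable {Ω : Type*} {mΩ : MeasurableSpace Ω} {ν : Measure Ω} {ℱ : Filtration ℕ mΩ}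
  {α b : ℕ → ℝ} {ρ κ : ℝ} {W G Δ : ℕ → Ω → ℝ} (h : IsStochasticDescent ν ℱ α b ρ κ W G Δ)
include h

lemma condExp_lyapunov_le_mul (k : ℕ) :
    ν[W (k + 1) | ℱ k] ≤ᵐ[ν] fun ω => (1 + b k) * W k ω := by
  filter_upwards [h.condExp_lyapunov_le k] with ω hω
  exact hω.trans (sub_le_self _
    (mul_nonneg h.rho_pos.le (mul_nonneg (h.step_nonneg k) (sq_nonneg _))))

variable [IsFiniteMeasure ν]

lemma summable_mul_integral_sq : Summable fun k => α k * ∫ ω, G k ω ^ 2 ∂ν := by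
  have hsum := summable_integral_of_condExp_le h.error_nonneg h.summable_error h.lyapunov_nonneg
    h.lyapunov_integrable (R := fun k ω => ρ * (α k * G k ω ^ 2))
    (fun k ω => mul_nonneg h.rho_pos.le (mul_nonneg (h.step_nonneg k) (sq_nonneg _)))
    (fun k => ((h.residual_memLp k).integrable_sq.const_mul _).const_mul _) h.condExp_lyapunov_le
  simp_rw [integral_const_mul] at hsum
  exact (summable_mul_left_iff h.rho_pos.ne').1 hsum

lemma exists_integral_bound_sq_le :
    ∃ H, 0 ≤ H ∧ ∀ k, ∫ ω, Δ k ω ^ 2 ∂ν ≤ H * α k ^ 2 := by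
  obtain ⟨c, hc⟩ := bddAbove_range_integral_of_condExp_le h.error_nonneg h.summable_error
    h.lyapunov_nonneg h.lyapunov_integrable h.condExp_lyapunov_le_mul
  have hκ := h.kappa_nonneg
  have hc₀ : 0 ≤ c := (integral_nonneg (h.lyapunov_nonneg 0)).trans (hc ⟨0, rfl⟩)
  refine ⟨κ * c, by positivity, fun k => ?_⟩
  refine (integral_le_of_condExp_le (ℱ.le k) ((h.lyapunov_integrable k).const_mul _)
    (h.condExp_bound_sq_le k)).trans ?_
  rw [integral_const_mul, mul_right_comm]
  gcongr
  exact hc ⟨k, rfl⟩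

theorem tendsto_integral_residual : Tendsto (fun k => ∫ ω, G k ω ∂ν) atTop (𝓝 0) := by
  obtain ⟨H, hH, hΔ_int⟩ := h.exists_integral_bound_sq_le
  have hG_int (k : ℕ) : Integrable (G k) ν := (h.residual_memLp k).integrable one_le_two
  have hsum : Summable fun k => α k * (∫ ω, G k ω ∂ν) ^ 2 := by
    refine (h.summable_mul_integral_sq.mul_left (ν.real Set.univ)).of_nonneg_of_le
      (fun k => mul_nonneg (h.step_nonneg k) (sq_nonneg _)) fun k => ?_
    rw [mul_left_comm]
    exact mul_le_mul_of_nonneg_left (sq_integral_le_measureReal_univ_mul (h.residual_memLp k))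
      (h.step_nonneg k)
  have hstep (k : ℕ) : ∫ ω, G k ω ∂ν - ∫ ω, G (k + 1) ω ∂ν ≤ √(ν.real Set.univ * H) * α k := by
    rw [← integral_sub (hG_int k) (hG_int (k + 1))]
    refine (integral_mono_ae ((hG_int k).sub (hG_int (k + 1)))
      ((h.bound_memLp k).integrable one_le_two) (h.residual_sub_le k)).trans
      (abs_le_of_sq_le_sq' ?_ (mul_nonneg (Real.sqrt_nonneg _) (h.step_nonneg k))).2
    rw [mul_pow, Real.sq_sqrt (by positivity), mul_assoc]
    exact (sq_integral_le_measureReal_univ_mul (h.bound_memLp k)).trans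
      (mul_le_mul_of_nonneg_left (hΔ_int k) measureReal_nonneg)
  refine tendsto_zero_of_summable_mul_sq h.step_nonneg h.not_summable hsum
    (fun k => integral_nonneg (h.residual_nonneg k)) (Real.sqrt_nonneg (ν.real Set.univ * H))
    (M := 0) (fun k => ?_) (cauchySeq_const 0)
  simpa using hstep k

theorem ae_tendsto_residual : ∀ᵐ ω ∂ν, Tendsto (fun k => G k ω) atTop (𝓝 0) := by
  have hsum : ∀ᵐ ω ∂ν, Summable fun k => α k * G k ω ^ 2 := by
    refine ae_summable_of_summable_integral
      (fun k ω => mul_nonneg (h.step_nonneg k) (sq_nonneg _))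
      (fun k => (h.residual_memLp k).integrable_sq.const_mul _) ?_
    simp_rw [integral_const_mul]
    exact h.summable_mul_integral_sq
  have hbdd := ae_bddAbove_range_of_condExp_le h.error_nonneg h.summable_error h.lyapunov_nonneg
    h.lyapunov_integrable h.lyapunov_adapted h.condExp_lyapunov_le_mul
  obtain ⟨H, -, hΔ_int⟩ := h.exists_integral_bound_sq_le
  have hmart := exists_ae_tendsto_sum_range_sub_condExp h.bound_adapted h.bound_memLp
    ((h.summable_sq.mul_left H).of_nonneg_of_le
      (fun k => integral_nonneg fun ω => sq_nonneg _) hΔ_int)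
  filter_upwards [hsum, hbdd, hmart, ae_all_iff.2 h.residual_sub_le,
    ae_all_iff.2 h.condExp_bound_sq_le,
    ae_all_iff.2 fun k => sq_condExp_ae_le (ℱ.le k) (h.bound_memLp k)]
    with ω hsum ⟨c, hc⟩ ⟨_, hmart⟩ hG_sub hΔ_sq hJensen
  have hκ := h.kappa_nonneg
  have hc₀ : 0 ≤ c := (h.lyapunov_nonneg 0 ω).trans (hc ⟨0, rfl⟩)
  have hdrift (k : ℕ) : ν[Δ k | ℱ k] ω ≤ √(κ * c) * α k := by
    refine (abs_le_of_sq_le_sq' ?_ (mul_nonneg (Real.sqrt_nonneg _) (h.step_nonneg k))).2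
    rw [mul_pow, Real.sq_sqrt (by positivity), mul_right_comm]
    exact (hJensen k).trans ((hΔ_sq k).trans
      (mul_le_mul_of_nonneg_left (hc ⟨k, rfl⟩) (by positivity)))
  refine tendsto_zero_of_summable_mul_sq h.step_nonneg h.not_summable hsum
    (fun k => h.residual_nonneg k ω) (Real.sqrt_nonneg (κ * c)) (fun k => ?_) hmart.cauchySeq
  rw [Finset.sum_range_succ]
  linarith [hG_sub k, hdrift k]

end IsStochasticDescent

section CondExpLE

variable {Ω : Type*} {m mΩ : MeasurableSpace Ω} {ν : Measure Ω} {X Z : Ω → ℝ}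

lemma integrable_of_lintegral_ofReal_le (hX_meas : AEStronglyMeasurable X ν) (hX : ∀ ω, 0 ≤ X ω)
    (hZ : Integrable Z ν)
    (hle : ∫⁻ ω, ENNReal.ofReal (X ω) ∂ν ≤ ∫⁻ ω, ENNReal.ofReal (Z ω) ∂ν) : Integrable X ν := by
  rw [← lintegral_ofReal_ne_top_iff_integrable hX_meas (ae_of_all _ hX)]
  exact (hle.trans_lt hZ.lintegral_lt_top).ne

lemma condExp_ae_le_of_forall_setLIntegral_ofReal_le (hm : m ≤ mΩ) [SigmaFinite (ν.trim hm)]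
    (hX : ∀ ω, 0 ≤ X ω) (hX_int : Integrable X ν) (hZ : ∀ ω, 0 ≤ Z ω)
    (hZ_meas : StronglyMeasurable[m] Z) (hZ_int : Integrable Z ν)
    (hle : ∀ B, MeasurableSet[m] B →
      ∫⁻ ω in B, ENNReal.ofReal (X ω) ∂ν ≤ ∫⁻ ω in B, ENNReal.ofReal (Z ω) ∂ν) :
    ν[X | m] ≤ᵐ[ν] Z := by
  refine ae_le_of_ae_le_trim (hm := hm) (ae_le_of_forall_setIntegral_le
    (integrable_condExp.trim hm stronglyMeasurable_condExp) (hZ_int.trim hm hZ_meas)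
    fun B hB _ => ?_)
  rw [← setIntegral_trim hm stronglyMeasurable_condExp hB, ← setIntegral_trim hm hZ_meas hB,
    setIntegral_condExp hm hX_int hB, ← ENNReal.ofReal_le_ofReal_iff (integral_nonneg hZ),
    ofReal_integral_eq_lintegral_ofReal hX_int.restrict (ae_of_all _ hX),
    ofReal_integral_eq_lintegral_ofReal hZ_int.restrict (ae_of_all _ hZ)]
  exact hle B hB

end CondExpLE

/-- The filtration `k ↦ ℱ (k + N)` of the tail of a process, used to discard the finitely many steps
of prox-SGD that are too long. -/
def shiftFiltration {Ω : Type*} {mΩ : MeasurableSpace Ω} (ℱ : Filtration ℕ mΩ) (N : ℕ) :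
    Filtration ℕ mΩ where
  seq k := ℱ (k + N)
  mono' _ _ hij := ℱ.mono (Nat.add_le_add_right hij N)
  le' k := ℱ.le (k + N)

/-- The iteration `x (k + 1) ∈ prox_{α k φ} (x k - α k • g k)` of prox-SGD for `f + φ` with
square-summable, non-summable steps and unbiased oracles `g`. The bound
`E[‖g k - ∇f (x k)‖² | ℱ k] ≤ C (f (x k) - fbar) + D` is integrated over the sets of `ℱ k`, so that
it passes to restricted measures. -/
structure IsProxSGD {E : Type*} [NormedAddCommGroup E] [InnerProductSpace ℝ E] [CompleteSpace E]
    (P : CompositeProblem E) {Ω : Type*} {mΩ : MeasurableSpace Ω} (ν : Measure Ω)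
    (ℱ : Filtration ℕ mΩ) (x g : ℕ → Ω → E) (α : ℕ → ℝ) (C D : ℝ) : Prop where
  step_pos : ∀ k, 0 < α k
  not_summable : ¬ Summable α
  summable_sq : Summable fun k => α k ^ 2
  adapted : StronglyAdapted ℱ x
  mem_proxSet : ∀ k, ∀ᵐ ω ∂ν, x (k + 1) ω ∈ proxSet (α k) P.φ (x k ω - α k • g k ω)
  integrable : ∀ k, Integrable (g k) ν
  unbiased : ∀ k, ν[g k | ℱ k] =ᵐ[ν] fun ω => gradient P.f (x k ω)
  C_nonneg : 0 ≤ C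
  D_nonneg : 0 ≤ D
  variance_le : ∀ k B, MeasurableSet[ℱ k] B →
    ∫⁻ ω in B, ‖g k ω - gradient P.f (x k ω)‖ₑ ^ 2 ∂ν
      ≤ ∫⁻ ω in B, ENNReal.ofReal (C * (P.f (x k ω) - P.fbar) + D) ∂ν

namespace IsProxSGD

variable {E : Type*} [NormedAddCommGroup E] [InnerProductSpace ℝ E] [CompleteSpace E]
  {P : CompositeProblem E} {Ω : Type*} {mΩ : MeasurableSpace Ω} {ν : Measure Ω}
  {ℱ : Filtration ℕ mΩ} {x g : ℕ → Ω → E} {α : ℕ → ℝ} {C D : ℝ}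
  (h : IsProxSGD P ν ℱ x g α C D)
include h

lemma ae_mem_effDom_succ (k : ℕ) : ∀ᵐ ω ∂ν, x (k + 1) ω ∈ effDom P.φ := by
  filter_upwards [h.mem_proxSet k] with ω hω using P.mem_effDom_of_step hω

lemma ae_mem_effDom (hdom : ∀ᵐ ω ∂ν, x 0 ω ∈ effDom P.φ) (k : ℕ) :
    ∀ᵐ ω ∂ν, x k ω ∈ effDom P.φ := by
  cases k with
  | zero => exact hdom
  | succ k => exact h.ae_mem_effDom_succ k

lemma stronglyMeasurable_gradient (k : ℕ) :
    StronglyMeasurable[ℱ k] fun ω => gradient P.f (x k ω) :=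
  P.lipschitz_gradient.continuous.comp_stronglyMeasurable (h.adapted k)

lemma stronglyMeasurable_proxPoint (k : ℕ) : StronglyMeasurable[ℱ k] fun ω => P.proxPoint (x k ω) :=
  P.continuous_proxPoint.comp_stronglyMeasurable (h.adapted k)

lemma stronglyMeasurable_merit (k : ℕ) : StronglyMeasurable[ℱ k] fun ω => P.merit (x k ω) :=
  P.continuous_merit.comp_stronglyMeasurable (h.adapted k)

lemma integrable_gradient (k : ℕ) : Integrable (fun ω => gradient P.f (x k ω)) ν :=
  integrable_condExp.congr (h.unbiased k)

lemma integrable_noise (k : ℕ) : Integrable (fun ω => g k ω - gradient P.f (x k ω)) ν :=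
  (h.integrable k).sub (h.integrable_gradient k)

lemma setLIntegral_noise_sq_le (k : ℕ) {B : Set Ω} (hB : MeasurableSet[ℱ k] B) :
    ∫⁻ ω in B, ENNReal.ofReal (‖g k ω - gradient P.f (x k ω)‖ ^ 2) ∂ν
      ≤ ∫⁻ ω in B, ENNReal.ofReal ((2 * C + D) * P.merit (x k ω)) ∂ν := by
  simp_rw [ENNReal.ofReal_pow (norm_nonneg _), ofReal_norm]
  refine (h.variance_le k B hB).trans (lintegral_mono fun ω => ENNReal.ofReal_le_ofReal ?_)
  have hC := mul_le_mul_of_nonneg_left (P.f_sub_le_merit (x k ω)) h.C_nonneg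
  have hD := mul_le_mul_of_nonneg_left (P.one_le_merit (x k ω)) h.D_nonneg
  linarith

section Moments

variable {k : ℕ} (hk : Integrable (fun ω => P.merit (x k ω)) ν)
include hk

lemma memLp_noise : MemLp (fun ω => g k ω - gradient P.f (x k ω)) 2 ν := by
  have hmeas := (h.integrable_noise k).aestronglyMeasurable
  rw [memLp_two_iff_integrable_sq_norm hmeas]
  exact integrable_of_lintegral_ofReal_le (hmeas.norm.pow 2) (fun ω => sq_nonneg _)
    (hk.const_mul (2 * C + D)) (by simpa using h.setLIntegral_noise_sq_le k MeasurableSet.univ)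

lemma memLp_sub_proxPoint : MemLp (fun ω => x k ω - P.proxPoint (x k ω)) 2 ν := by
  have hmeas : AEStronglyMeasurable (fun ω => x k ω - P.proxPoint (x k ω)) ν :=
    (((h.adapted k).sub (h.stronglyMeasurable_proxPoint k)).mono (ℱ.le k)).aestronglyMeasurable
  rw [memLp_two_iff_integrable_sq_norm hmeas]
  refine hk.mono' (hmeas.norm.pow 2) (ae_of_all _ fun ω => ?_)
  simpa using P.norm_sub_proxPoint_sq_le_merit (x k ω)

lemma integrable_norm_oracle_sq : Integrable (fun ω => ‖g k ω‖ ^ 2) ν := by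
  have hgrad : MemLp (fun ω => gradient P.f (x k ω)) 2 ν := by
    have hmeas := (h.integrable_gradient k).aestronglyMeasurable
    rw [memLp_two_iff_integrable_sq_norm hmeas]
    refine (hk.const_mul (4 * P.L)).mono' (hmeas.norm.pow 2) (ae_of_all _ fun ω => ?_)
    simpa using P.norm_gradient_sq_le_merit (x k ω)
  simpa using ((h.memLp_noise hk).add hgrad).integrable_norm_pow two_ne_zero

lemma integrable_merit_succ : Integrable (fun ω => P.merit (x (k + 1) ω)) ν := by
  refine ((hk.const_mul (1 + P.rate * (4 + 2 * α k))).add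
    ((h.integrable_norm_oracle_sq hk).const_mul (4 * P.rate * α k ^ 2))).mono'
    ((h.stronglyMeasurable_merit (k + 1)).mono (ℱ.le _)).aestronglyMeasurable ?_
  filter_upwards [h.mem_proxSet k] with ω hω
  rw [Real.norm_of_nonneg (P.merit_nonneg _)]
  exact P.merit_le_of_step_of_pos (h.step_pos k) hω

lemma memLp_increment (hdom : ∀ᵐ ω ∂ν, x k ω ∈ effDom P.φ) (hα : α k * P.τ ≤ 1) :
    MemLp (fun ω => ‖x (k + 1) ω - x k ω‖) 2 ν := by
  have hmeas : AEStronglyMeasurable (fun ω => ‖x (k + 1) ω - x k ω‖) ν :=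
    (((h.adapted (k + 1)).mono (ℱ.le _)).sub
      ((h.adapted k).mono (ℱ.le _))).norm.aestronglyMeasurable
  have hbound := ((hk.const_mul (P.Lφ ^ 2 + 8 * P.L)).add
    (((h.memLp_noise hk).integrable_norm_pow two_ne_zero).const_mul 2)).const_mul (8 * α k ^ 2)
  rw [memLp_two_iff_integrable_sq hmeas]
  refine hbound.mono' (hmeas.pow 2) ?_
  filter_upwards [hdom, h.mem_proxSet k] with ω hω hstep
  rw [Real.norm_of_nonneg (sq_nonneg _)]
  exact P.norm_step_sq_le (h.step_pos k) hα hω hstep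

variable [IsFiniteMeasure ν]

lemma condExp_noise_sq_le : ν[fun ω => ‖g k ω - gradient P.f (x k ω)‖ ^ 2 | ℱ k] ≤ᵐ[ν]
    fun ω => (2 * C + D) * P.merit (x k ω) := by
  have hCD : 0 ≤ 2 * C + D := by linarith [h.C_nonneg, h.D_nonneg]
  exact condExp_ae_le_of_forall_setLIntegral_ofReal_le (ℱ.le k) (fun ω => sq_nonneg _)
    ((h.memLp_noise hk).integrable_norm_pow two_ne_zero)
    (fun ω => mul_nonneg hCD (P.merit_nonneg _))
    ((h.stronglyMeasurable_merit k).const_mul _) (hk.const_mul _)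
    fun B hB => h.setLIntegral_noise_sq_le k hB

end Moments

lemma integrable_merit (hzero : Integrable (fun ω => P.merit (x 0 ω)) ν) (k : ℕ) :
    Integrable (fun ω => P.merit (x k ω)) ν := by
  induction k with
  | zero => exact hzero
  | succ k ih => exact h.integrable_merit_succ ih

lemma shift (N : ℕ) : IsProxSGD P ν (shiftFiltration ℱ N) (fun k => x (k + N))
    (fun k => g (k + N)) (fun k => α (k + N)) C D where
  step_pos k := h.step_pos (k + N)
  not_summable := (summable_nat_add_iff N).not.2 h.not_summable
  summable_sq := (summable_nat_add_iff N).2 h.summable_sq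
  adapted k := h.adapted (k + N)
  mem_proxSet k := by simpa only [add_right_comm k 1 N] using h.mem_proxSet (k + N)
  integrable k := h.integrable (k + N)
  unbiased k := h.unbiased (k + N)
  C_nonneg := h.C_nonneg
  D_nonneg := h.D_nonneg
  variance_le k := h.variance_le (k + N)

variable [IsFiniteMeasure ν]

lemma condExp_noise (k : ℕ) : ν[fun ω => g k ω - gradient P.f (x k ω) | ℱ k] =ᵐ[ν] 0 := by
  refine (condExp_sub (h.integrable k) (h.integrable_gradient k) _).trans ?_
  rw [condExp_of_stronglyMeasurable (ℱ.le k) (h.stronglyMeasurable_gradient k)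
    (h.integrable_gradient k)]
  filter_upwards [h.unbiased k] with ω hω
  simp [hω]

theorem condExp_merit_le {k : ℕ} (hk : Integrable (fun ω => P.merit (x k ω)) ν)
    (hα : α k * (P.rate + P.L) ≤ 1 / 2) :
    ν[fun ω => P.merit (x (k + 1) ω) | ℱ k] ≤ᵐ[ν] fun ω =>
      (1 + P.rate * (2 * C + D) * α k ^ 2) * P.merit (x k ω)
        - P.rate * (α k * ‖x k ω - P.proxPoint (x k ω)‖ ^ 2) := by
  set U : Ω → ℝ := fun ω => P.merit (x k ω) - P.rate * α k * ‖x k ω - P.proxPoint (x k ω)‖ ^ 2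
  set I : Ω → ℝ := fun ω => inner ℝ (P.proxPoint (x k ω) - x k ω) (g k ω - gradient P.f (x k ω))
  set S : Ω → ℝ := fun ω => ‖g k ω - gradient P.f (x k ω)‖ ^ 2
  have hdir_meas : StronglyMeasurable[ℱ k] fun ω => P.proxPoint (x k ω) - x k ω :=
    (h.stronglyMeasurable_proxPoint k).sub (h.adapted k)
  have hdir := h.memLp_sub_proxPoint hk
  have hU : Integrable U ν := hk.sub ((hdir.integrable_norm_pow two_ne_zero).const_mul _)
  have hU_meas : StronglyMeasurable[ℱ k] U := (h.stronglyMeasurable_merit k).sub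
    ((((h.adapted k).sub (h.stronglyMeasurable_proxPoint k)).norm.pow 2).const_mul _)
  have hI : Integrable I ν :=
    (hdir.norm.integrable_mul (h.memLp_noise hk).norm).mono'
      ((hdir_meas.mono (ℱ.le k)).aestronglyMeasurable.inner
        (h.integrable_noise k).aestronglyMeasurable)
      (ae_of_all _ fun ω => by
        simpa [norm_sub_rev] using norm_inner_le_norm (𝕜 := ℝ) (P.proxPoint (x k ω) - x k ω)
          (g k ω - gradient P.f (x k ω)))
  have hS : Integrable S ν := (h.memLp_noise hk).integrable_norm_pow two_ne_zero
  have hle : (fun ω => P.merit (x (k + 1) ω)) ≤ᵐ[ν]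
      U + (P.rate * α k) • I + (P.rate * α k ^ 2) • S := by
    filter_upwards [h.mem_proxSet k] with ω hω using P.merit_le_of_step (h.step_pos k) hα hω
  filter_upwards [condExp_mono (m := ℱ k) (h.integrable_merit_succ hk)
      ((hU.add (hI.smul _)).add (hS.smul _)) hle,
    condExp_add (hU.add (hI.smul (P.rate * α k))) (hS.smul (P.rate * α k ^ 2)) (ℱ k),
    condExp_add hU (hI.smul (P.rate * α k)) (ℱ k), condExp_smul (P.rate * α k) I (ℱ k),
    condExp_smul (P.rate * α k ^ 2) S (ℱ k),
    condExp_inner_eq_zero hdir_meas (h.integrable_noise k) hI (h.condExp_noise k),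
    h.condExp_noise_sq_le hk] with ω hmono hadd hadd' hI_smul hS_smul hI_zero hS_le
  rw [hadd, Pi.add_apply, hadd', Pi.add_apply, hI_smul, hS_smul, Pi.smul_apply, Pi.smul_apply,
    hI_zero, condExp_of_stronglyMeasurable (ℱ.le k) hU_meas hU] at hmono
  have := mul_le_mul_of_nonneg_left hS_le (mul_nonneg P.rate_pos.le (sq_nonneg (α k)))
  simp only [U, smul_eq_mul, Pi.zero_apply, mul_zero, add_zero] at hmono
  linarith

lemma condExp_increment_sq_le {k : ℕ} (hdom : ∀ᵐ ω ∂ν, x k ω ∈ effDom P.φ)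
    (hk : Integrable (fun ω => P.merit (x k ω)) ν) (hα : α k * P.τ ≤ 1) :
    ν[fun ω => ‖x (k + 1) ω - x k ω‖ ^ 2 | ℱ k] ≤ᵐ[ν] fun ω =>
      8 * (P.Lφ ^ 2 + 8 * P.L + 2 * (2 * C + D)) * α k ^ 2 * P.merit (x k ω) := by
  set U : Ω → ℝ := fun ω => (P.Lφ ^ 2 + 8 * P.L) * P.merit (x k ω)
  set S : Ω → ℝ := fun ω => ‖g k ω - gradient P.f (x k ω)‖ ^ 2
  have hU : Integrable U ν := hk.const_mul _
  have hU_meas : StronglyMeasurable[ℱ k] U := (h.stronglyMeasurable_merit k).const_mul _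
  have hS : Integrable S ν := (h.memLp_noise hk).integrable_norm_pow two_ne_zero
  have hle : (fun ω => ‖x (k + 1) ω - x k ω‖ ^ 2) ≤ᵐ[ν]
      (8 * α k ^ 2) • (U + (2 : ℝ) • S) := by
    filter_upwards [hdom, h.mem_proxSet k] with ω hω hstep
      using P.norm_step_sq_le (h.step_pos k) hα hω hstep
  filter_upwards [condExp_mono (m := ℱ k) (h.memLp_increment hk hdom hα).integrable_sq
      ((hU.add (hS.smul _)).smul _) hle,
    condExp_smul (8 * α k ^ 2) (U + (2 : ℝ) • S) (ℱ k),
    condExp_add hU (hS.smul (2 : ℝ)) (ℱ k), condExp_smul (2 : ℝ) S (ℱ k),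
    h.condExp_noise_sq_le hk] with ω hmono hsmul hadd hS_smul hS_le
  rw [hsmul, Pi.smul_apply, hadd, Pi.add_apply, hS_smul, Pi.smul_apply,
    condExp_of_stronglyMeasurable (ℱ.le k) hU_meas hU] at hmono
  have := mul_le_mul_of_nonneg_left hS_le (by positivity : 0 ≤ 16 * α k ^ 2)
  simp only [U, smul_eq_mul] at hmono
  linarith

theorem isStochasticDescent (hdom : ∀ᵐ ω ∂ν, x 0 ω ∈ effDom P.φ)
    (hzero : Integrable (fun ω => P.merit (x 0 ω)) ν)
    (hα : ∀ k, α k * (P.rate + P.L) ≤ 1 / 2) :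
    IsStochasticDescent ν ℱ α (fun k => P.rate * (2 * C + D) * α k ^ 2) P.rate
      ((1 + P.rate) ^ 2 * (8 * (P.Lφ ^ 2 + 8 * P.L + 2 * (2 * C + D))))
      (fun k ω => P.merit (x k ω)) (fun k ω => ‖x k ω - P.proxPoint (x k ω)‖)
      (fun k ω => (1 + P.rate) * ‖x (k + 1) ω - x k ω‖) where
  step_nonneg k := (h.step_pos k).le
  not_summable := h.not_summable
  summable_sq := h.summable_sq
  error_nonneg k := by
    have := P.rate_pos
    have := h.C_nonneg
    have := h.D_nonneg
    positivity
  summable_error := h.summable_sq.mul_left _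
  rho_pos := P.rate_pos
  kappa_nonneg := by
    have := h.C_nonneg
    have := h.D_nonneg
    positivity
  lyapunov_nonneg k ω := P.merit_nonneg _
  lyapunov_adapted := h.stronglyMeasurable_merit
  lyapunov_integrable := h.integrable_merit hzero
  residual_nonneg k ω := norm_nonneg _
  residual_memLp k := (h.memLp_sub_proxPoint (h.integrable_merit hzero k)).norm
  bound_adapted k :=
    (((h.adapted (k + 1)).sub ((h.adapted k).mono (ℱ.mono k.le_succ))).norm).const_mul _
  bound_memLp k := (h.memLp_increment (h.integrable_merit hzero k) (h.ae_mem_effDom hdom k)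
    (P.mul_τ_le_one (h.step_pos k) (hα k))).const_mul _
  condExp_lyapunov_le k := h.condExp_merit_le (h.integrable_merit hzero k) (hα k)
  residual_sub_le k := ae_of_all _ fun ω => P.norm_sub_proxPoint_sub_le _ _
  condExp_bound_sq_le k := by
    have hsq : (fun ω => (1 + P.rate) * ‖x (k + 1) ω - x k ω‖) ^ 2
        = (1 + P.rate) ^ 2 • fun ω => ‖x (k + 1) ω - x k ω‖ ^ 2 :=
      funext fun ω => by simp [mul_pow]
    rw [hsq]
    filter_upwards [condExp_smul ((1 + P.rate) ^ 2) (fun ω => ‖x (k + 1) ω - x k ω‖ ^ 2) (ℱ k),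
      h.condExp_increment_sq_le (h.ae_mem_effDom hdom k) (h.integrable_merit hzero k)
        (P.mul_τ_le_one (h.step_pos k) (hα k))] with ω hsmul hle
    rw [hsmul, Pi.smul_apply, smul_eq_mul, mul_assoc _ _ (P.merit _), mul_assoc _ _ (_ * _),
      ← mul_assoc _ _ (P.merit _)]
    exact mul_le_mul_of_nonneg_left hle (sq_nonneg _)

lemma restrict {A : Set Ω} (hA : MeasurableSet[ℱ 0] A) :
    IsProxSGD P (ν.restrict A) ℱ x g α C D where
  step_pos := h.step_pos
  not_summable := h.not_summable
  summable_sq := h.summable_sq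
  adapted := h.adapted
  mem_proxSet k := ae_restrict_of_ae (h.mem_proxSet k)
  integrable k := (h.integrable k).restrict
  unbiased k :=
    (condExp_restrict_ae_eq_restrict (ℱ.le k) (ℱ.mono k.zero_le _ hA) (h.integrable k)).trans
      (ae_restrict_of_ae (h.unbiased k))
  C_nonneg := h.C_nonneg
  D_nonneg := h.D_nonneg
  variance_le k B hB := by
    rw [Measure.restrict_restrict (ℱ.le k _ hB)]
    exact h.variance_le k _ (hB.inter (ℱ.mono k.zero_le _ hA))

lemma exists_isStochasticDescent_tail (hzero : Integrable (fun ω => P.merit (x 0 ω)) ν) :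
    ∃ (N : ℕ) (b : ℕ → ℝ) (ρ κ : ℝ) (Δ : ℕ → Ω → ℝ),
      IsStochasticDescent ν (shiftFiltration ℱ N) (fun k => α (k + N)) b ρ κ
        (fun k ω => P.merit (x (k + N) ω))
        (fun k ω => ‖x (k + N) ω - P.proxPoint (x (k + N) ω)‖) Δ := by
  have hα : Tendsto (fun k => α k * (P.rate + P.L)) atTop (𝓝 0) := by
    have hsqrt := h.summable_sq.tendsto_atTop_zero.sqrt.mul_const (P.rate + P.L)
    simpa only [Real.sqrt_sq (h.step_pos _).le, Real.sqrt_zero, zero_mul] using hsqrt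
  obtain ⟨N, hN⟩ := eventually_atTop.1 (hα.eventually_le_const one_half_pos)
  exact ⟨N + 1, _, _, _, _, (h.shift (N + 1)).isStochasticDescent
    (by simpa only [zero_add] using h.ae_mem_effDom_succ N)
    (by simpa only [zero_add] using h.integrable_merit hzero (N + 1))
    fun k => hN _ (by omega)⟩

theorem tendsto_integral_norm_sub_proxPoint (hzero : Integrable (fun ω => P.merit (x 0 ω)) ν) :
    Tendsto (fun k => ∫ ω, ‖x k ω - P.proxPoint (x k ω)‖ ∂ν) atTop (𝓝 0) := by
  obtain ⟨N, _, _, _, _, htail⟩ := h.exists_isStochasticDescent_tail hzero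
  exact (tendsto_add_atTop_iff_nat N).1 htail.tendsto_integral_residual

lemma ae_tendsto_norm_sub_proxPoint_of_integrable
    (hzero : Integrable (fun ω => P.merit (x 0 ω)) ν) :
    ∀ᵐ ω ∂ν, Tendsto (fun k => ‖x k ω - P.proxPoint (x k ω)‖) atTop (𝓝 0) := by
  obtain ⟨N, _, _, _, _, htail⟩ := h.exists_isStochasticDescent_tail hzero
  filter_upwards [htail.ae_tendsto_residual] with ω hω using (tendsto_add_atTop_iff_nat N).1 hω

theorem ae_tendsto_norm_sub_proxPoint :
    ∀ᵐ ω ∂ν, Tendsto (fun k => ‖x k ω - P.proxPoint (x k ω)‖) atTop (𝓝 0) := by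
  have hlocal (m : ℕ) : ∀ᵐ ω ∂ν, P.merit (x 0 ω) ≤ m →
      Tendsto (fun k => ‖x k ω - P.proxPoint (x k ω)‖) atTop (𝓝 0) := by
    have hA : MeasurableSet[ℱ 0] {ω | P.merit (x 0 ω) ≤ m} :=
      (h.stronglyMeasurable_merit 0).measurable measurableSet_Iic
    refine (ae_restrict_iff' (ℱ.le 0 _ hA)).1
      ((h.restrict hA).ae_tendsto_norm_sub_proxPoint_of_integrable ?_)
    refine (integrable_const (m : ℝ)).mono'
      ((h.stronglyMeasurable_merit 0).mono (ℱ.le 0)).aestronglyMeasurable ?_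
    filter_upwards [ae_restrict_mem (ℱ.le 0 _ hA)] with ω hω
    rwa [Real.norm_of_nonneg (P.merit_nonneg _)]
  filter_upwards [ae_all_iff.2 hlocal] with ω hω
  obtain ⟨m, hm⟩ := exists_nat_ge (P.merit (x 0 ω))
  exact hω m hm

lemma integrable_merit_zero {θ : ℝ} (hθ : 0 < θ)
    (hint : ∫⁻ ω, (moreauEnv θ P.objective (x 0 ω)).toENNReal ∂ν < ⊤) :
    Integrable (fun ω => P.merit (x 0 ω)) ν := by
  rw [← lintegral_ofReal_ne_top_iff_integrable
    ((h.stronglyMeasurable_merit 0).mono (ℱ.le 0)).aestronglyMeasurable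
    (ae_of_all _ fun ω => P.merit_nonneg _)]
  refine ((lintegral_mono fun ω => P.ofReal_merit_le_moreauEnv hθ (x 0 ω)).trans_lt ?_).ne
  rw [lintegral_const_mul' _ _ ENNReal.ofReal_ne_top, lintegral_add_right _ measurable_const,
    lintegral_const]
  exact ENNReal.mul_lt_top ENNReal.ofReal_lt_top (ENNReal.add_lt_top.2 ⟨hint,
    ENNReal.mul_lt_top ENNReal.ofReal_lt_top (measure_lt_top _ _)⟩)

section NaturalResidual

variable {lam : ℝ} (hlam : 0 < lam) (hlt : lam * P.τ < 1)
include hlam hlt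

lemma integrable_natRes (hzero : Integrable (fun ω => P.merit (x 0 ω)) ν) (k : ℕ) :
    Integrable (fun ω => natRes lam P.f P.φ (x k ω)) ν :=
  (((h.memLp_sub_proxPoint (h.integrable_merit hzero k)).integrable one_le_two).norm.const_mul
    _).mono' (((P.continuous_natRes hlam hlt).comp_stronglyMeasurable
      (h.adapted k)).mono (ℱ.le k)).aestronglyMeasurable
    (ae_of_all _ fun ω => P.norm_natRes_le hlam hlt (x k ω))

theorem tendsto_integral_norm_natRes (hzero : Integrable (fun ω => P.merit (x 0 ω)) ν) :
    Tendsto (fun k => ∫ ω, ‖natRes lam P.f P.φ (x k ω)‖ ∂ν) atTop (𝓝 0) := by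
  have hlim := (h.tendsto_integral_norm_sub_proxPoint hzero).const_mul
    (1 + (P.rate + P.L + lam⁻¹) / (lam⁻¹ - P.τ))
  rw [mul_zero] at hlim
  refine squeeze_zero (fun k => integral_nonneg fun ω => norm_nonneg _) (fun k => ?_) hlim
  rw [← integral_const_mul]
  exact integral_mono (h.integrable_natRes hlam hlt hzero k).norm
    (((h.memLp_sub_proxPoint (h.integrable_merit hzero k)).integrable one_le_two).norm.const_mul _)
    fun ω => P.norm_natRes_le hlam hlt (x k ω)

theorem ae_tendsto_norm_natRes :
    ∀ᵐ ω ∂ν, Tendsto (fun k => ‖natRes lam P.f P.φ (x k ω)‖) atTop (𝓝 0) := by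
  filter_upwards [h.ae_tendsto_norm_sub_proxPoint] with ω hω
  have hlim := hω.const_mul (1 + (P.rate + P.L + lam⁻¹) / (lam⁻¹ - P.τ))
  rw [mul_zero] at hlim
  exact squeeze_zero (fun k => norm_nonneg _) (fun k => P.norm_natRes_le hlam hlt (x k ω)) hlim

end NaturalResidual

end IsProxSGD

theorem corollary3p6_general {E : Type*} [NormedAddCommGroup E] [InnerProductSpace ℝ E]
    [CompleteSpace E] {Ω : Type*} {mΩ : MeasurableSpace Ω} (μ : Measure Ω) [IsFiniteMeasure μ]
    (ℱ : Filtration ℕ mΩ)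
    (f : E → ℝ) (φ : E → EReal)
    (x g : ℕ → Ω → E) (α : ℕ → ℝ)
    (L : NNReal) (fbar φbar τ Lφ C D : ℝ)
    (hf_diff : Differentiable ℝ f)
    (hf_lip : LipschitzWith L (gradient f))
    (hf_bdd : ∀ y, fbar ≤ f y)
    (hτ : 0 ≤ τ)
    (hφ_wcvx : WeaklyConvex τ φ)
    (hφ_proper : (effDom φ).Nonempty)
    (hφ_lsc : LowerSemicontinuous φ)
    (hφ_bdd : ∀ y, (φbar : EReal) ≤ φ y)
    (hφ_lip : ∀ y ∈ effDom φ, ∀ z ∈ effDom φ, (φ y).toReal - (φ z).toReal ≤ Lφ * ‖y - z‖)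
    (hα_pos : ∀ k, 0 < α k)
    (hα_sum : ¬ Summable α)
    (hα_sq : Summable (fun k => α k ^ 2))
    (hx_adapted : StronglyAdapted ℱ x)
    (hx_step : ∀ k, ∀ᵐ ω ∂μ, x (k + 1) ω ∈ proxSet (α k) φ (x k ω - α k • g k ω))
    (hg_int : ∀ k, Integrable (g k) μ)
    (hg_unbiased : ∀ k, μ[g k | ℱ k] =ᵐ[μ] fun ω => gradient f (x k ω))
    (hC : 0 ≤ C) (hD : 0 ≤ D)
    (hg_var : ∀ k, ∀ᵐ ω ∂μ,
      condLExp (ℱ k) μ (fun ω' => ‖g k ω' - gradient f (x k ω')‖ₑ ^ 2) ω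
        ≤ ENNReal.ofReal (C * (f (x k ω) - fbar) + D))
    (lam : ℝ) (hlam_pos : 0 < lam) (hlam : lam * τ < 1) :
    ((∃ θ : ℝ, 0 < θ ∧
        ∫⁻ ω, (moreauEnv θ (fun y => (f y : EReal) + φ y) (x 0 ω)).toENNReal ∂μ < ⊤) →
      (∀ k, Integrable (fun ω => natRes lam f φ (x k ω)) μ) ∧
      Tendsto (fun k => ∫ ω, ‖natRes lam f φ (x k ω)‖ ∂μ) atTop (𝓝 0)) ∧
    (∀ᵐ ω ∂μ, Tendsto (fun k => ‖natRes lam f φ (x k ω)‖) atTop (𝓝 0)) := by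
  let P : CompositeProblem E := ⟨f, φ, L, τ, fbar, φbar, Lφ, hf_diff, hf_lip, hf_bdd, hτ, hφ_wcvx,
    hφ_proper, hφ_lsc, hφ_bdd, hφ_lip⟩
  have h : IsProxSGD P μ ℱ x g α C D :=
    { step_pos := hα_pos
      not_summable := hα_sum
      summable_sq := hα_sq
      adapted := hx_adapted
      mem_proxSet := hx_step
      integrable := hg_int
      unbiased := hg_unbiased
      C_nonneg := hC
      D_nonneg := hD
      variance_le := fun k B hB => by
        rw [← setLIntegral_condLExp (ℱ.le k) μ _ hB]
        exact lintegral_mono_ae (ae_restrict_of_ae (hg_var k)) }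
  refine ⟨fun ⟨θ, hθ, hint⟩ => ?_, h.ae_tendsto_norm_natRes hlam_pos hlam⟩
  have hzero := h.integrable_merit_zero hθ hint
  exact ⟨h.integrable_natRes hlam_pos hlam hzero,
    h.tendsto_integral_norm_natRes hlam_pos hlam hzero⟩

theorem corollary3p6 (n : ℕ)
    {Ω : Type*} [mΩ : MeasurableSpace Ω] (μ : Measure Ω) [IsProbabilityMeasure μ]
    (ℱ : Filtration ℕ mΩ)
    (f : EuclideanSpace ℝ (Fin n) → ℝ) (φ : EuclideanSpace ℝ (Fin n) → EReal)
    (x g : ℕ → Ω → EuclideanSpace ℝ (Fin n)) (α : ℕ → ℝ)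
    (L : NNReal) (fbar φbar τ Lφ C D : ℝ)
    -- the smooth part: bounded below, with Lipschitz continuous gradient
    (hf_diff : Differentiable ℝ f)
    (hf_lip : LipschitzWith L (gradient f))
    (hf_bdd : ∀ y, fbar ≤ f y)
    -- the nonsmooth part: weakly convex, proper, lower semicontinuous, bounded below
    (hτ : 0 ≤ τ)
    (hφ_wcvx : WeaklyConvex τ φ)
    (hφ_proper : (effDom φ).Nonempty)
    (hφ_lsc : LowerSemicontinuous φ)
    (hφ_bdd : ∀ y, (φbar : EReal) ≤ φ y)
    -- Lipschitz continuity on the effective domain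
    (hφ_lip : ∀ y ∈ effDom φ, ∀ z ∈ effDom φ, (φ y).toReal - (φ z).toReal ≤ Lφ * ‖y - z‖)
    -- step sizes
    (hα_pos : ∀ k, 0 < α k)
    (hα_sum : ¬ Summable α)
    (hα_sq : Summable (fun k => α k ^ 2))
    -- the iterates of prox-SGD, adapted to the filtration
    (hx_adapted : StronglyAdapted ℱ x)
    (hx_step : ∀ k, ∀ᵐ ω ∂μ, x (k + 1) ω ∈ proxSet (α k) φ (x k ω - α k • g k ω))
    -- unbiased oracles with the ABC-type conditional variance bound
    (hg_int : ∀ k, Integrable (g k) μ)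
    (hg_unbiased : ∀ k, μ[g k | ℱ k] =ᵐ[μ] fun ω => gradient f (x k ω))
    (hC : 0 ≤ C) (hD : 0 ≤ D)
    (hg_var : ∀ k, ∀ᵐ ω ∂μ,
      condLExp (ℱ k) μ (fun ω' => ‖g k ω' - gradient f (x k ω')‖ₑ ^ 2) ω
        ≤ ENNReal.ofReal (C * (f (x k ω) - fbar) + D))
    -- the parameter of the natural residual
    (lam : ℝ) (hlam_pos : 0 < lam) (hlam : lam * τ < 1) :
    ((∃ θ : ℝ, 0 < θ ∧
        ∫⁻ ω, (moreauEnv θ (fun y => (f y : EReal) + φ y) (x 0 ω)).toENNReal ∂μ < ⊤) →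
      (∀ k, Integrable (fun ω => natRes lam f φ (x k ω)) μ) ∧
      Tendsto (fun k => ∫ ω, ‖natRes lam f φ (x k ω)‖ ∂μ) atTop (𝓝 0)) ∧
    (∀ᵐ ω ∂μ, Tendsto (fun k => ‖natRes lam f φ (x k ω)‖) atTop (𝓝 0)) :=
  corollary3p6_general μ ℱ f φ x g α L fbar φbar τ Lφ C D hf_diff hf_lip hf_bdd hτ hφ_wcvx
    hφ_proper hφ_lsc hφ_bdd hφ_lip hα_pos hα_sum hα_sq hx_adapted hx_step hg_int hg_unbiased hC hD
    hg_var lam hlam_pos hlam
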